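/- Let $n\ge 2$. For every $c>0$ and every $\varepsilon>0$ there is a constant $C=C(n,c,\varepsilon)$ such that the following holds for every $0<\delta<1$. Let $\mathcal E$ be any $\delta$-net of the cube $Q=[-1,1]^{n-1}\subset\mathbf R^{n-1}$, i.e. a $\delta$-separated subset of $Q$ such that every point of $Q$ lies within distance $\delta$ of $\mathcal E$. For $\omega,i\in\mathcal E$ let $$T_\omega^i=\{(\underline y,y_n)\in\mathbf R^{n-1}\times\mathbf R:\ |y_n|\le 1,\ |\underline y-y_n\omega-i|\le\delta\},$$ and for $h:\mathcal E\times\mathcal E\to[0,\infty)$ put $$X^*h(x)=\sum_{\omega\in\mathcal E}\sum_{i\in\mathcal E}h(\omega,i)\,\chi_{T_\omega^i}(x)\quad(x\in\mathbf R^n),\qquad \|h\|_{L^{a}_\omega L^1_i}=\Big(\delta^{n-1}\sum_{\omega\in\mathcal E}\Big(\sum_{i\in\mathcal E}h(\omega,i)\Big)^{a}\Big)^{1/a}.$$ Let $\mathcal E_1,\mathcal E_2\subset\mathcal E$ satisfy $|\omega_1-\omega_2|\ge c$ for all $\omega_1\in\mathcal E_1$, $\omega_2\in\mathcal E_2$,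 and let $f,g:\mathcal E\times\mathcal E\to[0,\infty)$ be supported on $\mathcal E_1\times\mathcal E$ and $\mathcal E_2\times\mathcal E$ respectively. Then $$\|X^*f\;X^*g\|_{L^{\frac{n+2}{2n}}(\mathbf R^n)}\ \le\ C\,\delta^{-\varepsilon}\,\delta^{-\frac{2(n-2)}{n+2}}\;\|f\|_{L^{\frac{n+2}{n+1}}_\omega L^1_i}\;\|g\|_{L^{\frac{n+2}{n+1}}_\omega L^1_i}.$$ In other words, the bilinear Kakeya estimate $K^*\big(\tfrac{n+2}{n+1}\times\tfrac{n+2}{n+1}\to\tfrac{n+2}{2n}\big)$ holds in every dimension $n\ge2$. Here, with $a,r>0$ and $p$ defined by $\tfrac1p=1-\tfrac1{2r}$ (so that $r=p'/2$), $K^*(a\times a\to r)$ denotes the same assertion with $\tfrac{n+2}{n+1}$, $\tfrac{n+2}{2n}$ and $\delta^{-\frac{2(n-2)}{n+2}}$ replaced by $a$, $r$ and $\delta^{-\frac{2n}{p}+2}$ (and $C$ allowed to depend on $a$ and $r$ also). -/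

import Mathlib

open scoped BigOperators
open MeasureTheory

noncomputable section

/-- The cube `[-1,1]^m` in `ℝ^m`. -/
def unitCube (m : ℕ) : Set (EuclideanSpace ℝ (Fin m)) :=
  {x | ∀ k, |x k| ≤ 1}

/-- `E` is a `δ`-net of the set `Q`: a `δ`-separated subset of `Q` such that every point of `Q`
is within distance `δ` of `E`. -/
structure IsDeltaNet {m : ℕ} (δ : ℝ) (Q : Set (EuclideanSpace ℝ (Fin m)))
    (E : Finset (EuclideanSpace ℝ (Fin m))) : Prop where
  subset : ∀ x ∈ E, x ∈ Q
  separated : ∀ x ∈ E, ∀ y ∈ E, x ≠ y → δ ≤ dist x y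
  covers : ∀ x ∈ Q, ∃ y ∈ E, dist x y ≤ δ

/-- The `δ × 1` tube with direction `ω` and base `i`. A point of `ℝ^(m+1)` is written as a pair
`y = (y.1, y.2)`, where `y.1 ∈ ℝ^m` collects the first `m` coordinates and `y.2` is the last one. -/
def kakeyaTube {m : ℕ} (δ : ℝ) (ω i : EuclideanSpace ℝ (Fin m)) :
    Set (EuclideanSpace ℝ (Fin m) × ℝ) :=
  {y | |y.2| ≤ 1 ∧ ‖y.1 - y.2 • ω - i‖ ≤ δ}

/-- The adjoint discretized x-ray transform `X* g = ∑_ω ∑_i g(ω,i) χ_{T_ω^i}`. -/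
def xrayAdjoint {m : ℕ} (δ : ℝ) (E : Finset (EuclideanSpace ℝ (Fin m)))
    (g : EuclideanSpace ℝ (Fin m) → EuclideanSpace ℝ (Fin m) → ℝ)
    (x : EuclideanSpace ℝ (Fin m) × ℝ) : ℝ :=
  ∑ ω ∈ E, ∑ i ∈ E, g ω i * (kakeyaTube δ ω i).indicator (fun _ => (1 : ℝ)) x

/-- The norm `‖g‖` in `L^a_ω L^1_i` on `E × E` for a non-negative function `g`, where `i` carries
counting measure and `ω` carries counting measure times `δ^m`. -/
def mixedNorm {m : ℕ} (δ : ℝ) (E : Finset (EuclideanSpace ℝ (Fin m))) (a : ℝ)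
    (g : EuclideanSpace ℝ (Fin m) → EuclideanSpace ℝ (Fin m) → ℝ) : ℝ :=
  (∑ ω ∈ E, δ ^ m * (∑ i ∈ E, g ω i) ^ a) ^ (1 / a)

/-- The bilinear Kakeya estimate `K*(a × a → r)` in `ℝ^n`. The power of `δ` is `-2n/p + 2`, where
`p` is the exponent with `p'/2 = r`, that is, `1/p = 1 - 1/(2r)`; the factor `δ^(-ε)` is the
permitted loss, and `c` is the separation of the two sets of directions. The constant `C`
depends only on `n`, `a`, `r`, `c` and `ε`. -/
def BilinearKakeya (n : ℕ) (a r : ℝ) : Prop :=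
  ∀ c : ℝ, 0 < c → ∀ ε : ℝ, 0 < ε → ∃ C : ℝ, 0 < C ∧
    ∀ δ : ℝ, 0 < δ → δ < 1 →
    ∀ E : Finset (EuclideanSpace ℝ (Fin (n - 1))), IsDeltaNet δ (unitCube (n - 1)) E →
    ∀ E₁ E₂ : Finset (EuclideanSpace ℝ (Fin (n - 1))), E₁ ⊆ E → E₂ ⊆ E →
    (∀ ω₁ ∈ E₁, ∀ ω₂ ∈ E₂, c ≤ dist ω₁ ω₂) →
    ∀ f g : EuclideanSpace ℝ (Fin (n - 1)) → EuclideanSpace ℝ (Fin (n - 1)) → ℝ,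
    (∀ ω i, 0 ≤ f ω i) → (∀ ω i, 0 ≤ g ω i) →
    (∀ ω i, ω ∉ E₁ → f ω i = 0) → (∀ ω i, ω ∉ E₂ → g ω i = 0) →
      eLpNorm (fun x => xrayAdjoint δ E f x * xrayAdjoint δ E g x) (ENNReal.ofReal r) volume
        ≤ ENNReal.ofReal
          (C * δ ^ (-ε) * δ ^ (-(2 * (n : ℝ) * (1 - 1 / (2 * r))) + 2)
            * mixedNorm δ E a f * mixedNorm δ E a g)

end

/-!
The estimate is a bilinear form of Wolff's hairbrush argument; write `n = m + 1`.

Let `Ω` be a set on which `X*f ≥ α` and `X*g ≥ β`, and suppose that `∑ i, g ω i ≤ A` for each `ω`.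
Discard the tubes of `g` that meet `Ω` in less than half of the average proportion `λ`. By double
counting some tube `T₀` of `f` meets many of the remaining ones. Since the directions of `f` and `g`
are separated, all of these tubes cross `T₀` transversally. They form a hairbrush with stem `T₀`,
and outside the `λ`-neighbourhood of `T₀` two of them can meet only if their directions almost lie
in a common plane with that of `T₀`. Córdoba's `L²` argument inside these planes
(`exists_hairbrush_overlap_le`, resting on the geometric lemma `exists_smul_sub_norm_le_of_hairbrush`
and the counting lemma `exists_sum_inv_dist_strip_le`) bounds the total mass of the hairbrush.
No assumption of one tube per direction is needed, as only `∑ i, g ω i` enters. Comparing the two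
bounds for the mass gives `exists_hairbrush_weak_type`:
`α β^(m+2) |Ω|^(m+1) ≲ A ‖f‖₁ ‖g‖₁^(m+1) δ^(1+m(m+1))`, up to a logarithm.

The geometric mean of this bound and the one with `f` and `g` exchanged has exactly the exponents of
the theorem. It is a restricted weak-type bound at the endpoint, in which the norm of `f` appears as
`(‖F‖_∞ ‖F‖₁^(m+2))^(1/(m+3))`, where `F ω = ∑ i, f ω i`. As a loss of `δ^(-ε)` is allowed, it is
upgraded to the strong type by splitting the values of `X*f` and `X*g`
(`exists_lintegral_rpow_le_of_sup_le`) and those of `F` and `G`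
(`exists_level_decomposition`, `exists_lintegral_rpow_le`) into boundedly many levels with ratio a
small power of `δ`. The exponent `r = (n+2)/(2n)` is at most one, so `t ↦ t^r` is subadditive and
the pieces may be added up.
-/

/-! ### Counting separated directions near a line -/

lemma EuclideanSpace.norm_le_sum_abs {m : ℕ} (x : EuclideanSpace ℝ (Fin m)) :
    ‖x‖ ≤ ∑ l, |x l| := by
  rw [EuclideanSpace.norm_eq]
  apply Real.sqrt_le_iff.2
  refine ⟨Finset.sum_nonneg fun _ _ => abs_nonneg _, ?_⟩
  have := Finset.sum_sq_le_sq_sum_of_nonneg (s := Finset.univ) (f := fun l => |x l|)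
    (fun _ _ => abs_nonneg _)
  simpa using this

lemma EuclideanSpace.abs_apply_le_norm {m : ℕ} (x : EuclideanSpace ℝ (Fin m)) (l : Fin m) :
    |x l| ≤ ‖x‖ := by
  simpa using PiLp.norm_apply_le x l

lemma abs_sub_apply_le_of_mem_unitCube {m : ℕ} {x y : EuclideanSpace ℝ (Fin m)}
    (hx : x ∈ unitCube m) (hy : y ∈ unitCube m) (l : Fin m) : |(x - y) l| ≤ 2 := by
  have h1 := hx l
  have h2 := hy l
  rw [PiLp.sub_apply]
  calc _ ≤ |x l| + |y l| := abs_sub _ _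
    _ ≤ 2 := by linarith

lemma norm_sub_le_of_mem_unitCube {m : ℕ} {x y : EuclideanSpace ℝ (Fin m)}
    (hx : x ∈ unitCube m) (hy : y ∈ unitCube m) : ‖x - y‖ ≤ 2 * m := by
  refine (EuclideanSpace.norm_le_sum_abs _).trans ?_
  refine (Finset.sum_le_sum fun l _ => abs_sub_apply_le_of_mem_unitCube hx hy l).trans ?_
  simp [mul_comm]

/-- A symmetric piece of the harmonic series. -/
lemma sum_Icc_inv_abs_add_one_le (P : ℕ) :
    ∑ p ∈ Finset.Icc (-(P : ℤ)) P, 1 / (|(p : ℝ)| + 1) ≤ 2 * (1 + Real.log (P + 1)) := by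
  have hH : ∑ q ∈ Finset.range (P + 1), 1 / ((q : ℝ) + 1) ≤ 1 + Real.log (P + 1) := by
    have h := harmonic_le_one_add_log (P + 1)
    simp only [harmonic] at h
    push_cast at h
    simpa using h
  have hsub : Finset.Icc (-(P : ℤ)) P ⊆
      (Finset.range (P + 1)).image (fun q : ℕ => (q : ℤ)) ∪
      (Finset.range (P + 1)).image (fun q : ℕ => -(q : ℤ)) := by
    intro p hp
    simp only [Finset.mem_Icc] at hp
    simp only [Finset.mem_union, Finset.mem_image, Finset.mem_range]
    rcases le_total 0 p with h | h
    · exact Or.inl ⟨p.toNat, by omega, by omega⟩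
    · exact Or.inr ⟨(-p).toNat, by omega, by omega⟩
  have h0 : ∀ p : ℤ, 0 ≤ 1 / (|(p : ℝ)| + 1) := fun p => by positivity
  calc _ ≤ ∑ p ∈ (Finset.range (P + 1)).image (fun q : ℕ => (q : ℤ)) ∪
      (Finset.range (P + 1)).image (fun q : ℕ => -(q : ℤ)), 1 / (|(p : ℝ)| + 1) :=
        Finset.sum_le_sum_of_subset_of_nonneg hsub fun p _ _ => h0 p
    _ ≤ ∑ p ∈ (Finset.range (P + 1)).image (fun q : ℕ => (q : ℤ)), 1 / (|(p : ℝ)| + 1) +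
        ∑ p ∈ (Finset.range (P + 1)).image (fun q : ℕ => -(q : ℤ)), 1 / (|(p : ℝ)| + 1) := by
        rw [← Finset.sum_union_inter]
        exact le_add_of_nonneg_right (Finset.sum_nonneg fun p _ => h0 p)
    _ = ∑ q ∈ Finset.range (P + 1), 1 / ((q : ℝ) + 1) +
        ∑ q ∈ Finset.range (P + 1), 1 / ((q : ℝ) + 1) := by
        rw [Finset.sum_image (by intro a _ b _ h; simpa using h),
          Finset.sum_image (by intro a _ b _ h; simpa using h)]
        simp
    _ ≤ _ := by linarith

lemma sum_comp_le_sum_of_injOn {ι κ : Type*} {S : Finset ι} {t : Finset κ} {φ : ι → κ}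
    {H : κ → ℝ} (hmem : ∀ x ∈ S, φ x ∈ t) (hinj : Set.InjOn φ S) (hH : ∀ q, 0 ≤ H q) :
    ∑ x ∈ S, H (φ x) ≤ ∑ q ∈ t, H q := by
  classical
  rw [← Finset.sum_image hinj]
  refine Finset.sum_le_sum_of_subset_of_nonneg ?_ fun q _ _ => hH q
  intro q hq
  obtain ⟨ω, hω, rfl⟩ := Finset.mem_image.1 hq
  exact hmem ω hω

/-- Kernel sum over the directions of a `δ`-separated set lying in the `η`-neighbourhood of a line:
the neighbourhood contains about `(η/δ)^(m-1)` points for each step of length `δ` along the line,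
and summing the kernel along the line costs a logarithm. -/
lemma exists_sum_inv_dist_strip_le (m : ℕ) (hm : 1 ≤ m) : ∃ C : ℝ, 0 < C ∧
    ∀ δ : ℝ, 0 < δ → δ < 1 → ∀ η : ℝ, δ ≤ η →
    ∀ S : Finset (EuclideanSpace ℝ (Fin m)), (∀ x ∈ S, x ∈ unitCube m) →
    (∀ x ∈ S, ∀ y ∈ S, x ≠ y → δ ≤ dist x y) →
    ∀ ω₀ ω' : EuclideanSpace ℝ (Fin m), ω' ∈ unitCube m → ω' ≠ ω₀ →
    (∀ ω ∈ S, ∃ κ : ℝ, ‖(ω - ω₀) - κ • (ω' - ω₀)‖ ≤ η) →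
    ∑ ω ∈ S, 1 / (‖ω - ω'‖ + δ) ≤ C * (η / δ) ^ (m - 1) * δ⁻¹ * (1 + Real.log (1 / δ)) := by
  have hmR : (1 : ℝ) ≤ m := by exact_mod_cast hm
  have hlogm : 0 ≤ Real.log (4 * m + 2) := Real.log_nonneg (by linarith)
  refine ⟨4 * m * (1 + Real.log (4 * m + 2)) * (8 * m + 3) ^ (m - 1), by positivity, ?_⟩
  intro δ hδ hδ1 η hη S hcube hsep ω₀ ω' hω' hne hstrip
  have : Nonempty (Fin m) := ⟨⟨0, hm⟩⟩
  set v := ω' - ω₀ with hv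
  obtain ⟨k, hk⟩ := Finite.exists_max fun l => |v l|
  have hvk : v k ≠ 0 := by
    intro h0
    apply hne
    rw [← sub_eq_zero]
    ext l
    have := hk l
    rw [h0, abs_zero] at this
    simpa [hv] using abs_nonpos_iff.1 this
  set s : Fin m → ℝ := fun l => v l / v k with hs
  have hs1 : ∀ l, |s l| ≤ 1 := fun l => by
    rw [hs]; simp only [abs_div]
    exact (div_le_one (abs_pos.2 hvk)).2 (hk l)
  -- shear the line onto the `k`-th coordinate axis and discretize at scale `d`
  set d : ℝ := δ / (2 * m) with hd
  have hd0 : 0 < d := by positivity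
  have hδd : δ = 2 * m * d := by rw [hd]; field_simp
  set w : EuclideanSpace ℝ (Fin m) → Fin m → ℝ := fun ω l =>
    if l = k then (ω - ω') k else (ω - ω') l - s l * (ω - ω') k with hw
  set φ : EuclideanSpace ℝ (Fin m) → Fin m → ℤ := fun ω l => ⌊w ω l / d⌋ with hφ
  set P : ℕ := ⌈2 / d⌉₊ with hP
  set R : ℕ := ⌈2 * η / d⌉₊ with hR
  set t : Fin m → Finset ℤ := fun l => if l = k then Finset.Icc (-(P : ℤ)) P
    else Finset.Icc (-(R : ℤ)) R with ht
  set h : Fin m → ℤ → ℝ := fun l p => if l = k then 1 / (d * (|(p : ℝ)| + 1)) else 1 with hh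
  have floor_mem : ∀ (x B : ℝ), |x| ≤ B → ⌊x / d⌋ ∈ Finset.Icc (-(⌈B / d⌉₊ : ℤ)) ⌈B / d⌉₊ := by
    intro x B hxB
    have h1 := abs_le.1 hxB
    have hc : B / d ≤ ⌈B / d⌉₊ := Nat.le_ceil _
    have h2 : x / d ≤ B / d := by gcongr; exact h1.2
    have h3 : -(B / d) ≤ x / d := by rw [← neg_div]; gcongr; exact h1.1
    rw [Finset.mem_Icc]
    constructor
    · apply Int.le_floor.2
      push_cast
      linarith
    · have : (⌊x / d⌋ : ℝ) ≤ ⌈B / d⌉₊ := (Int.floor_le _).trans (by linarith)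
      exact_mod_cast this
  have hmem : ∀ ω ∈ S, φ ω ∈ Fintype.piFinset t := by
    intro ω hω
    rw [Fintype.mem_piFinset]
    intro l
    by_cases hl : l = k
    · subst hl
      simp only [hφ, ht, hw, if_true]
      exact floor_mem _ _ (abs_sub_apply_le_of_mem_unitCube (hcube ω hω) hω' _)
    · simp only [hφ, ht, hw, if_neg hl]
      apply floor_mem
      obtain ⟨κ, hκ⟩ := hstrip ω hω
      set e := (ω - ω₀) - κ • v with he
      have h1 : ω - ω' = (κ - 1) • v + e := by rw [he, hv]; module
      have h2 : (ω - ω') l - s l * (ω - ω') k = e l - s l * e k := by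
        rw [h1]
        simp only [PiLp.add_apply, PiLp.smul_apply, smul_eq_mul, hs]
        field_simp
        ring
      rw [h2]
      have h3 := (EuclideanSpace.abs_apply_le_norm e l).trans hκ
      have h4 := (EuclideanSpace.abs_apply_le_norm e k).trans hκ
      calc |e l - s l * e k| ≤ |e l| + |s l * e k| := abs_sub _ _
        _ = |e l| + |s l| * |e k| := by rw [abs_mul]
        _ ≤ η + 1 * η := by gcongr; exact hs1 l
        _ = 2 * η := by ring
  have hinj : Set.InjOn φ S := by
    intro x hx y hy hxy
    by_contra hxy'
    have hge := hsep x hx y hy hxy'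
    have hcell : ∀ l, |w x l - w y l| < d := by
      intro l
      have h1 : ⌊w x l / d⌋ = ⌊w y l / d⌋ := congrFun hxy l
      have h2 := Int.abs_sub_lt_one_of_floor_eq_floor h1
      rwa [← sub_div, abs_div, abs_of_pos hd0, div_lt_one hd0] at h2
    have hK : |(x - y) k| < d := by
      have := hcell k
      simp only [hw, if_true] at this
      convert this using 2
      simp
    have hlt : ∀ l, |(x - y) l| < 2 * d := by
      intro l
      by_cases hl : l = k
      · subst hl; linarith
      · have h1 := hcell l
        simp only [hw, if_neg hl] at h1
        have h2 : (x - y) l = ((x - ω') l - s l * (x - ω') k -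
            ((y - ω') l - s l * (y - ω') k)) + s l * (x - y) k := by
          simp only [PiLp.sub_apply]; ring
        rw [h2]
        calc _ ≤ _ := abs_add_le _ _
          _ < d + |s l * (x - y) k| := by linarith
          _ = d + |s l| * |(x - y) k| := by rw [abs_mul]
          _ ≤ d + 1 * d := by gcongr; exact hs1 l
          _ = 2 * d := by ring
    have h5 : dist x y < δ := by
      rw [dist_eq_norm]
      refine (EuclideanSpace.norm_le_sum_abs _).trans_lt ?_
      refine (Finset.sum_lt_sum_of_nonempty Finset.univ_nonempty fun l _ => hlt l).trans_eq ?_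
      rw [Finset.sum_const, Finset.card_univ, Fintype.card_fin, nsmul_eq_mul, hδd]
      ring
    linarith
  have hpt : ∀ ω, 1 / (‖ω - ω'‖ + δ) ≤ ∏ l, h l (φ ω l) := by
    intro ω
    have h1 : ∏ l, h l (φ ω l) = 1 / (d * (|(φ ω k : ℝ)| + 1)) := by
      rw [Finset.prod_eq_single k]
      · simp [hh]
      · intro l _ hl; simp [hh, hl]
      · simp
    rw [h1]
    apply one_div_le_one_div_of_le (by positivity)
    have h2 : |(φ ω k : ℝ)| ≤ |(ω - ω') k| / d + 1 := by
      have h3 : φ ω k = ⌊(ω - ω') k / d⌋ := by simp [hφ, hw]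
      rw [h3, ← abs_of_pos hd0, ← abs_div, abs_of_pos hd0]
      have h4 := Int.floor_le ((ω - ω') k / d)
      have h5 := Int.lt_floor_add_one ((ω - ω') k / d)
      rw [abs_le]
      constructor
      · linarith [neg_abs_le ((ω - ω') k / d)]
      · linarith [le_abs_self ((ω - ω') k / d)]
    have h6 := EuclideanSpace.abs_apply_le_norm (ω - ω') k
    calc d * (|(φ ω k : ℝ)| + 1) ≤ d * (|(ω - ω') k| / d + 1 + 1) := by gcongr
      _ = |(ω - ω') k| + 2 * d := by field_simp; ring
      _ ≤ ‖ω - ω'‖ + δ := by rw [hδd]; nlinarith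
  have hnn : ∀ l p, 0 ≤ h l p := by
    intro l p; simp only [hh]; split_ifs <;> positivity
  have hmain : ∑ ω ∈ S, 1 / (‖ω - ω'‖ + δ) ≤ ∏ l, ∑ p ∈ t l, h l p := by
    have hprod : ∏ l, ∑ p ∈ t l, h l p = ∑ q ∈ Fintype.piFinset t, ∏ l, h l (q l) :=
      Finset.prod_univ_sum t h
    rw [hprod]
    clear_value φ t h
    refine (Finset.sum_le_sum fun ω _ => hpt ω).trans ?_
    exact sum_comp_le_sum_of_injOn (H := fun q => ∏ l, h l (q l)) hmem hinj
      fun q => Finset.prod_nonneg fun l _ => hnn _ _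
  refine hmain.trans ?_
  rw [← Finset.mul_prod_erase _ _ (Finset.mem_univ k)]
  have hfst : ∑ p ∈ t k, h k p ≤ 4 * m * δ⁻¹ * (1 + Real.log (P + 1)) := by
    have h1 : ∑ p ∈ t k, h k p = d⁻¹ * ∑ p ∈ Finset.Icc (-(P : ℤ)) P, 1 / (|(p : ℝ)| + 1) := by
      rw [Finset.mul_sum]
      simp only [ht, hh, if_true]
      refine Finset.sum_congr rfl fun p _ => ?_
      rw [one_div, mul_inv, one_div]
    rw [h1]
    refine (mul_le_mul_of_nonneg_left (sum_Icc_inv_abs_add_one_le P) (by positivity)).trans_eq ?_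
    rw [hd]; field_simp; ring
  have hlog : 1 + Real.log (P + 1) ≤ (1 + Real.log (4 * m + 2)) * (1 + Real.log (1 / δ)) := by
    have hPle : (P : ℝ) + 1 ≤ (4 * m + 2) * (1 / δ) := by
      have h1 : (P : ℝ) < 2 / d + 1 := Nat.ceil_lt_add_one (by positivity)
      have h2 : 2 / d = 4 * m * (1 / δ) := by rw [hd]; field_simp; ring
      have h3 : 1 ≤ 1 / δ := by rw [le_div_iff₀ hδ]; linarith
      nlinarith
    have h4 : Real.log (P + 1) ≤ Real.log (4 * m + 2) + Real.log (1 / δ) := by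
      rw [← Real.log_mul (by positivity) (by positivity)]
      exact Real.log_le_log (by positivity) hPle
    have h5 : 0 ≤ Real.log (1 / δ) := Real.log_nonneg (by rw [le_div_iff₀ hδ]; linarith)
    nlinarith
  have hrest : ∏ l ∈ Finset.univ.erase k, ∑ p ∈ t l, h l p ≤ ((8 * m + 3) * (η / δ)) ^ (m - 1) := by
    have hcard : (Finset.univ.erase k).card = m - 1 := by
      rw [Finset.card_erase_of_mem (Finset.mem_univ k)]; simp
    rw [← hcard, ← Finset.prod_const]
    refine Finset.prod_le_prod (fun l _ => Finset.sum_nonneg fun p _ => hnn l p) fun l hl => ?_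
    have hlk := Finset.ne_of_mem_erase hl
    simp only [ht, hh, if_neg hlk, Finset.sum_const, nsmul_eq_mul, mul_one, Int.card_Icc]
    have h1 : (R : ℝ) < 2 * η / d + 1 := by
      have := hδ.trans_le hη
      exact Nat.ceil_lt_add_one (by positivity)
    have h2 : 2 * η / d = 4 * m * (η / δ) := by rw [hd]; field_simp; ring
    have h3 : 1 ≤ η / δ := (one_le_div hδ).2 hη
    have h4 : ((R : ℤ) + 1 - -(R : ℤ)).toNat = 2 * R + 1 := by omega
    rw [h4]
    push_cast
    nlinarith
  have hP0 : 0 ≤ 1 + Real.log ((P : ℝ) + 1) := by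
    have := Real.log_nonneg (x := (P : ℝ) + 1) (le_add_of_nonneg_left (Nat.cast_nonneg P))
    linarith
  calc _ ≤ (4 * m * δ⁻¹ * (1 + Real.log (P + 1))) * ((8 * m + 3) * (η / δ)) ^ (m - 1) := by
        refine mul_le_mul hfst hrest ?_ (mul_nonneg (by positivity) hP0)
        exact Finset.prod_nonneg fun l _ => Finset.sum_nonneg fun p _ => hnn l p
    _ ≤ (4 * m * δ⁻¹ * ((1 + Real.log (4 * m + 2)) * (1 + Real.log (1 / δ)))) *
        ((8 * m + 3) * (η / δ)) ^ (m - 1) := by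
        have h1 : 0 ≤ η / δ := div_nonneg (hδ.le.trans hη) hδ.le
        exact mul_le_mul_of_nonneg_right (mul_le_mul_of_nonneg_left hlog (by positivity))
          (by positivity)
    _ = _ := by rw [mul_pow]; ring

/-- Up to a logarithm, a `δ`-separated subset of the cube has at most `δ^(-m)` points. -/
lemma exists_card_le_of_separated (m : ℕ) (hm : 1 ≤ m) : ∃ C : ℝ, 0 < C ∧
    ∀ δ : ℝ, 0 < δ → δ < 1 →
    ∀ S : Finset (EuclideanSpace ℝ (Fin m)), (∀ x ∈ S, x ∈ unitCube m) →
    (∀ x ∈ S, ∀ y ∈ S, x ≠ y → δ ≤ dist x y) →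
    (S.card : ℝ) ≤ C * (δ ^ m)⁻¹ * (1 + Real.log (1 / δ)) := by
  obtain ⟨C, hC, h⟩ := exists_sum_inv_dist_strip_le m hm
  have hmR : (1 : ℝ) ≤ m := by exact_mod_cast hm
  refine ⟨(2 * m + 1) * (C * (2 * m) ^ (m - 1)), by positivity, ?_⟩
  intro δ hδ hδ1 S hcube hsep
  have hlog : 0 ≤ Real.log (1 / δ) := Real.log_nonneg (by rw [le_div_iff₀ hδ]; linarith)
  rcases S.eq_empty_or_nonempty with rfl | ⟨x, hx⟩
  · simp only [Finset.card_empty, Nat.cast_zero]; positivity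
  -- the cube is itself contained in a thick strip
  have hk := h δ hδ hδ1 (2 * m) (by linarith) S hcube hsep
    (x - EuclideanSpace.single ⟨0, hm⟩ 1) x (hcube x hx)
    (by
      intro h0
      have h1 : EuclideanSpace.single (⟨0, hm⟩ : Fin m) (1 : ℝ) = 0 := by
        rw [eq_comm, sub_eq_self] at h0; exact h0
      simpa using congrArg norm h1)
    (fun ω hω => ⟨1, by
      rw [one_smul, sub_sub_sub_cancel_right]
      exact norm_sub_le_of_mem_unitCube (hcube ω hω) (hcube x hx)⟩)
  have hlow : (S.card : ℝ) * (1 / (2 * m + 1)) ≤ ∑ ω ∈ S, 1 / (‖ω - x‖ + δ) := by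
    rw [← nsmul_eq_mul]
    refine Finset.card_nsmul_le_sum _ _ _ fun ω hω => ?_
    apply one_div_le_one_div_of_le (by positivity)
    have := norm_sub_le_of_mem_unitCube (hcube ω hω) (hcube x hx)
    linarith
  have h3 := hlow.trans hk
  rw [mul_one_div, div_le_iff₀ (by positivity)] at h3
  refine h3.trans_eq ?_
  have h4 : (δ ^ m)⁻¹ = (δ ^ (m - 1))⁻¹ * δ⁻¹ := by
    rw [← mul_inv, ← pow_succ, Nat.sub_add_cancel hm]
  rw [h4, div_pow]
  ring

/-! ### Geometry of tubes -/

lemma isClosed_kakeyaTube {m : ℕ} (δ : ℝ) (ω i : EuclideanSpace ℝ (Fin m)) :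
    IsClosed (kakeyaTube δ ω i) := by
  have h1 : IsClosed {y : EuclideanSpace ℝ (Fin m) × ℝ | |y.2| ≤ 1} :=
    isClosed_le (by fun_prop) (by fun_prop)
  have h2 : IsClosed {y : EuclideanSpace ℝ (Fin m) × ℝ | ‖y.1 - y.2 • ω - i‖ ≤ δ} :=
    isClosed_le (by fun_prop) (by fun_prop)
  exact h1.inter h2

lemma measurableSet_kakeyaTube {m : ℕ} (δ : ℝ) (ω i : EuclideanSpace ℝ (Fin m)) :
    MeasurableSet (kakeyaTube δ ω i) :=
  (isClosed_kakeyaTube δ ω i).measurableSet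

/-- Volume of the unit ball of `ℝ^m`, the cross-section of a tube of radius one. -/
noncomputable def unitBallVolume (m : ℕ) : ℝ :=
  (volume : Measure (EuclideanSpace ℝ (Fin m))).real (Metric.ball 0 1)

lemma unitBallVolume_pos (m : ℕ) : 0 < unitBallVolume m :=
  ENNReal.toReal_pos (Metric.measure_ball_pos _ _ one_pos).ne' measure_ball_lt_top.ne

/-- A part of a tube whose points have last coordinates within `l` of each other. -/
lemma volume_le_of_subset_kakeyaTube {m : ℕ} {δ l : ℝ} (hδ : 0 ≤ δ)
    {ω i : EuclideanSpace ℝ (Fin m)} {S : Set (EuclideanSpace ℝ (Fin m) × ℝ)}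
    (hS : S ⊆ kakeyaTube δ ω i) (hSl : ∀ p ∈ S, ∀ q ∈ S, |p.2 - q.2| ≤ l) :
    volume S ≤ ENNReal.ofReal (unitBallVolume m * δ ^ m * (2 * l)) := by
  rcases S.eq_empty_or_nonempty with rfl | ⟨q, hq⟩
  · simp
  set S' : Set (EuclideanSpace ℝ (Fin m) × ℝ) :=
    kakeyaTube δ ω i ∩ {p | p.2 ∈ Set.Icc (q.2 - l) (q.2 + l)} with hS'
  have hsub : S ⊆ S' := fun p hp => ⟨hS hp, by
    have := abs_le.1 (hSl p hp q hq)
    constructor <;> linarith⟩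
  have hmeas : MeasurableSet S' :=
    (measurableSet_kakeyaTube δ ω i).inter (measurable_snd measurableSet_Icc)
  have hball : volume (Metric.closedBall (0 : EuclideanSpace ℝ (Fin m)) δ)
      = ENNReal.ofReal (unitBallVolume m * δ ^ m) := by
    rw [Measure.addHaar_closedBall _ _ hδ, mul_comm, ENNReal.ofReal_mul (unitBallVolume_pos m).le,
      unitBallVolume, ofReal_measureReal]
    simp
  refine (measure_mono hsub).trans ?_
  rw [Measure.volume_eq_prod, Measure.prod_apply_symm hmeas]
  have hpt : ∀ t : ℝ, volume ((fun x : EuclideanSpace ℝ (Fin m) => (x, t)) ⁻¹' S') ≤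
      (Set.Icc (q.2 - l) (q.2 + l)).indicator
        (fun _ => ENNReal.ofReal (unitBallVolume m * δ ^ m)) t := by
    intro t
    by_cases ht : t ∈ Set.Icc (q.2 - l) (q.2 + l)
    · rw [Set.indicator_of_mem ht, ← hball,
        ← Measure.addHaar_closedBall_center volume (t • ω + i)]
      refine measure_mono fun x hx => ?_
      have h1 : ‖x - t • ω - i‖ ≤ δ := hx.1.2
      rw [mem_closedBall_iff_norm, ← sub_sub]
      exact h1
    · rw [Set.indicator_of_notMem ht]
      have : (fun x : EuclideanSpace ℝ (Fin m) => (x, t)) ⁻¹' S' = ∅ := by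
        ext x; simp only [Set.mem_preimage, Set.mem_empty_iff_false, iff_false]
        exact fun hx => ht hx.2
      rw [this, measure_empty]
  refine (lintegral_mono hpt).trans_eq ?_
  rw [lintegral_indicator_const measurableSet_Icc, Real.volume_Icc,
    ← ENNReal.ofReal_mul (mul_nonneg (unitBallVolume_pos m).le (pow_nonneg hδ m))]
  congr 2
  ring

lemma measureReal_restrict_le_of_subset_kakeyaTube {m : ℕ} {δ l : ℝ} (hδ : 0 ≤ δ) (hl : 0 ≤ l)
    {ω i : EuclideanSpace ℝ (Fin m)} {S : Set (EuclideanSpace ℝ (Fin m) × ℝ)}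
    (hS : S ⊆ kakeyaTube δ ω i) (hSl : ∀ p ∈ S, ∀ q ∈ S, |p.2 - q.2| ≤ l)
    (Ω : Set (EuclideanSpace ℝ (Fin m) × ℝ)) :
    (volume.restrict Ω).real S ≤ unitBallVolume m * δ ^ m * (2 * l) := by
  have h0 : 0 ≤ unitBallVolume m * δ ^ m * (2 * l) :=
    mul_nonneg (mul_nonneg (unitBallVolume_pos m).le (pow_nonneg hδ m)) (by linarith)
  exact ENNReal.toReal_le_of_le_ofReal h0
    ((Measure.restrict_apply_le _ _).trans (volume_le_of_subset_kakeyaTube hδ hS hSl))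

/-- The tubes meet only while their axes are `2δ`-close, that is for a time of order
`δ / (‖ω - ω'‖ + δ)`. -/
lemma abs_sub_le_of_mem_inter_kakeyaTube {m : ℕ} {δ : ℝ} (hδ : 0 < δ)
    {ω i ω' i' : EuclideanSpace ℝ (Fin m)} {p q : EuclideanSpace ℝ (Fin m) × ℝ}
    (hp : p ∈ kakeyaTube δ ω i ∩ kakeyaTube δ ω' i')
    (hq : q ∈ kakeyaTube δ ω i ∩ kakeyaTube δ ω' i') :
    |p.2 - q.2| ≤ 6 * δ / (‖ω - ω'‖ + δ) := by
  rw [le_div_iff₀ (by positivity)]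
  obtain ⟨⟨hp1, hp2⟩, -, hp3⟩ := hp
  obtain ⟨⟨hq1, hq2⟩, -, hq3⟩ := hq
  have h1 : |p.2 - q.2| ≤ 2 := (abs_sub _ _).trans (by linarith)
  have h2 : |p.2 - q.2| * ‖ω - ω'‖ ≤ 4 * δ := by
    rw [← Real.norm_eq_abs, ← norm_smul]
    have : (p.2 - q.2) • (ω - ω') = (p.1 - p.2 • ω' - i') - (p.1 - p.2 • ω - i)
        - ((q.1 - q.2 • ω' - i') - (q.1 - q.2 • ω - i)) := by module
    rw [this]
    have h3 := norm_sub_le ((p.1 - p.2 • ω' - i') - (p.1 - p.2 • ω - i))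
      ((q.1 - q.2 • ω' - i') - (q.1 - q.2 • ω - i))
    have h4 := norm_sub_le (p.1 - p.2 • ω' - i') (p.1 - p.2 • ω - i)
    have h5 := norm_sub_le (q.1 - q.2 • ω' - i') (q.1 - q.2 • ω - i)
    linarith
  nlinarith

/-- A tube stays in the `ρ`-neighbourhood of a transversal one for a time of order `ρ + δ`. -/
lemma abs_sub_le_of_mem_neighbourhood {m : ℕ} {δ ρ c : ℝ} (hc : 0 < c)
    {ω i ω₀ i₀ : EuclideanSpace ℝ (Fin m)} (hω : c ≤ ‖ω - ω₀‖)
    {p q : EuclideanSpace ℝ (Fin m) × ℝ}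
    (hp : p ∈ kakeyaTube δ ω i) (hp' : ‖p.1 - p.2 • ω₀ - i₀‖ ≤ ρ)
    (hq : q ∈ kakeyaTube δ ω i) (hq' : ‖q.1 - q.2 • ω₀ - i₀‖ ≤ ρ) :
    |p.2 - q.2| ≤ 2 * (ρ + δ) / c := by
  rw [le_div_iff₀ hc]
  have h2 : |p.2 - q.2| * ‖ω - ω₀‖ ≤ 2 * (ρ + δ) := by
    rw [← Real.norm_eq_abs, ← norm_smul]
    have : (p.2 - q.2) • (ω - ω₀) = (p.1 - p.2 • ω₀ - i₀) - (p.1 - p.2 • ω - i)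
        - ((q.1 - q.2 • ω₀ - i₀) - (q.1 - q.2 • ω - i)) := by module
    rw [this]
    have h3 := norm_sub_le ((p.1 - p.2 • ω₀ - i₀) - (p.1 - p.2 • ω - i))
      ((q.1 - q.2 • ω₀ - i₀) - (q.1 - q.2 • ω - i))
    have h4 := norm_sub_le (p.1 - p.2 • ω₀ - i₀) (p.1 - p.2 • ω - i)
    have h5 := norm_sub_le (q.1 - q.2 • ω₀ - i₀) (q.1 - q.2 • ω - i)
    linarith [hp.2, hq.2]
  exact (mul_le_mul_of_nonneg_left hω (abs_nonneg _)).trans h2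

/-- Hairbrush geometry: two tubes of directions `ω`, `ω'` that both meet a tube `T₀` of direction
`ω₀`, and that meet each other away from `T₀`, lie with `T₀` near a common plane, so that
`ω - ω₀` is nearly parallel to `ω' - ω₀`. -/
lemma exists_smul_sub_norm_le_of_hairbrush {m : ℕ} (hm : 1 ≤ m) {δ ρ : ℝ} (hδ : 0 < δ)
    (hρ : 6 * δ ≤ ρ) {ω i ω' i' ω₀ i₀ : EuclideanSpace ℝ (Fin m)} (hω : ‖ω - ω₀‖ ≤ 2 * m)
    (h : (kakeyaTube δ ω₀ i₀ ∩ kakeyaTube δ ω i).Nonempty)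
    (h' : (kakeyaTube δ ω₀ i₀ ∩ kakeyaTube δ ω' i').Nonempty)
    {p : EuclideanSpace ℝ (Fin m) × ℝ} (hp : p ∈ kakeyaTube δ ω i)
    (hp' : p ∈ kakeyaTube δ ω' i') (hpρ : ρ < ‖p.1 - p.2 • ω₀ - i₀‖) :
    ∃ κ : ℝ, ‖(ω - ω₀) - κ • (ω' - ω₀)‖ ≤ 24 * m * δ / ρ := by
  obtain ⟨q, ⟨-, hq0⟩, -, hq⟩ := h
  obtain ⟨s, ⟨-, hs0⟩, -, hs⟩ := h'
  have hp1 := hp.2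
  have hp2 := hp'.2
  have hmR : (1 : ℝ) ≤ m := by exact_mod_cast hm
  have hρ0 : 0 < ρ := by linarith
  have e1 : p.1 - p.2 • ω₀ - i₀ = (p.2 - q.2) • (ω - ω₀) + ((p.1 - p.2 • ω - i)
      - (q.1 - q.2 • ω - i) + (q.1 - q.2 • ω₀ - i₀)) := by module
  have h1 : ρ / 2 ≤ |p.2 - q.2| * ‖ω - ω₀‖ := by
    rw [← Real.norm_eq_abs, ← norm_smul]
    have a1 := norm_add_le ((p.2 - q.2) • (ω - ω₀)) ((p.1 - p.2 • ω - i)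
      - (q.1 - q.2 • ω - i) + (q.1 - q.2 • ω₀ - i₀))
    have a2 := norm_add_le ((p.1 - p.2 • ω - i) - (q.1 - q.2 • ω - i)) (q.1 - q.2 • ω₀ - i₀)
    have a3 := norm_sub_le (p.1 - p.2 • ω - i) (q.1 - q.2 • ω - i)
    rw [← e1] at a1
    linarith
  have h2 : ρ / (4 * m) ≤ |p.2 - q.2| := by
    rw [div_le_iff₀ (by positivity)]
    nlinarith [abs_nonneg (p.2 - q.2)]
  have h3 : 0 < |p.2 - q.2| := lt_of_lt_of_le (by positivity) h2
  have h4 : p.2 - q.2 ≠ 0 := abs_pos.1 h3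
  have h5 : ‖(p.2 - q.2) • (ω - ω₀) - (p.2 - s.2) • (ω' - ω₀)‖ ≤ 6 * δ := by
    have e2 : (p.2 - q.2) • (ω - ω₀) - (p.2 - s.2) • (ω' - ω₀) =
        ((p.1 - p.2 • ω' - i') - (s.1 - s.2 • ω' - i') + (s.1 - s.2 • ω₀ - i₀)) -
        ((p.1 - p.2 • ω - i) - (q.1 - q.2 • ω - i) + (q.1 - q.2 • ω₀ - i₀)) := by module
    rw [e2]
    have a1 := norm_sub_le
      ((p.1 - p.2 • ω' - i') - (s.1 - s.2 • ω' - i') + (s.1 - s.2 • ω₀ - i₀))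
      ((p.1 - p.2 • ω - i) - (q.1 - q.2 • ω - i) + (q.1 - q.2 • ω₀ - i₀))
    have a2 := norm_add_le ((p.1 - p.2 • ω - i) - (q.1 - q.2 • ω - i)) (q.1 - q.2 • ω₀ - i₀)
    have a3 := norm_sub_le (p.1 - p.2 • ω - i) (q.1 - q.2 • ω - i)
    have a4 := norm_add_le ((p.1 - p.2 • ω' - i') - (s.1 - s.2 • ω' - i')) (s.1 - s.2 • ω₀ - i₀)
    have a5 := norm_sub_le (p.1 - p.2 • ω' - i') (s.1 - s.2 • ω' - i')
    linarith
  refine ⟨(p.2 - s.2) / (p.2 - q.2), ?_⟩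
  have e3 : (ω - ω₀) - ((p.2 - s.2) / (p.2 - q.2)) • (ω' - ω₀) =
      (p.2 - q.2)⁻¹ • ((p.2 - q.2) • (ω - ω₀) - (p.2 - s.2) • (ω' - ω₀)) := by
    rw [smul_sub (p.2 - q.2)⁻¹, smul_smul, smul_smul, inv_mul_cancel₀ h4, one_smul,
      div_eq_inv_mul]
  rw [e3, norm_smul, norm_inv, Real.norm_eq_abs, inv_mul_le_iff₀ h3]
  refine h5.trans ?_
  calc 6 * δ = ρ / (4 * m) * (24 * m * δ / ρ) := by field_simp; norm_num
    _ ≤ _ := by gcongr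

/-! ### Overlaps of weighted families of sets -/

/-- Cauchy–Schwarz for a weighted family of sets. -/
lemma sq_sum_measureReal_le {X ι : Type*} [MeasurableSpace X] (μ : Measure X) [IsFiniteMeasure μ]
    (s : Finset ι) (a : ι → ℝ) (T : ι → Set X) (hT : ∀ j ∈ s, MeasurableSet (T j)) :
    (∑ j ∈ s, a j * μ.real (T j)) ^ 2 ≤
      μ.real Set.univ * ∑ j ∈ s, ∑ k ∈ s, a j * a k * μ.real (T j ∩ T k) := by
  set I := ∑ j ∈ s, a j * μ.real (T j) with hI
  set W := μ.real Set.univ with hW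
  set D := ∑ j ∈ s, ∑ k ∈ s, a j * a k * μ.real (T j ∩ T k) with hD
  have hint : ∀ j ∈ s, Integrable ((T j).indicator fun _ => (1 : ℝ)) μ := fun j hj =>
    (integrable_const _).indicator (hT j hj)
  have hint2 : ∀ j ∈ s, ∀ k ∈ s, Integrable ((T j ∩ T k).indicator fun _ => (1 : ℝ)) μ :=
    fun j hj k hk => (integrable_const _).indicator ((hT j hj).inter (hT k hk))
  set h : X → ℝ := fun x => ∑ j ∈ s, a j * (T j).indicator (fun _ => (1 : ℝ)) x with hh
  have h1 : ∫ x, h x ∂μ = I := by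
    simp only [hh]
    rw [integral_finsetSum _ fun j hj => (hint j hj).const_mul _]
    refine Finset.sum_congr rfl fun j hj => ?_
    rw [integral_const_mul, integral_indicator_const _ (hT j hj)]; simp
  have hsq : ∀ x, h x ^ 2 = ∑ j ∈ s, ∑ k ∈ s, a j * a k *
      (T j ∩ T k).indicator (fun _ => (1 : ℝ)) x := by
    intro x
    rw [sq, hh, Finset.sum_mul_sum]
    refine Finset.sum_congr rfl fun j _ => Finset.sum_congr rfl fun k _ => ?_
    have : (T j ∩ T k).indicator (fun _ => (1 : ℝ)) x =
        (T j).indicator (fun _ => (1 : ℝ)) x * (T k).indicator (fun _ => (1 : ℝ)) x := by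
      by_cases hj : x ∈ T j <;> by_cases hk : x ∈ T k <;> simp [hj, hk]
    rw [this]; ring
  have hi2 : Integrable (fun x => h x ^ 2) μ := by
    simp only [hsq]
    exact integrable_finsetSum _ fun j hj => integrable_finsetSum _ fun k hk =>
      (hint2 j hj k hk).const_mul _
  have h2 : ∫ x, h x ^ 2 ∂μ = D := by
    simp only [hsq]
    rw [integral_finsetSum _ fun j hj => integrable_finsetSum _ fun k hk =>
      (hint2 j hj k hk).const_mul _]
    refine Finset.sum_congr rfl fun j hj => ?_
    rw [integral_finsetSum _ fun k hk => (hint2 j hj k hk).const_mul _]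
    refine Finset.sum_congr rfl fun k hk => ?_
    rw [integral_const_mul, integral_indicator_const _ ((hT j hj).inter (hT k hk))]; simp
  have hi1 : Integrable h μ := integrable_finsetSum _ fun j hj => (hint j hj).const_mul _
  -- expand `∫ (W h - I)² ≥ 0`
  have h3 : 0 ≤ ∫ x, (W * h x - I) ^ 2 ∂μ := integral_nonneg fun x => sq_nonneg _
  have h4 : ∫ x, (W * h x - I) ^ 2 ∂μ = W * (W * D - I ^ 2) := by
    have e : ∀ x, (W * h x - I) ^ 2 = (W ^ 2 * h x ^ 2 - 2 * W * I * h x) + I ^ 2 := by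
      intro x; ring
    simp only [e]
    have hi3 : Integrable (fun x => W ^ 2 * h x ^ 2 - 2 * W * I * h x) μ :=
      (hi2.const_mul _).sub (hi1.const_mul _)
    rw [integral_add hi3 (integrable_const _),
      integral_sub (hi2.const_mul _) (hi1.const_mul _), integral_const_mul, integral_const_mul,
      h1, h2, integral_const, ← hW, smul_eq_mul]
    ring
  rw [h4] at h3
  rcases (measureReal_nonneg : 0 ≤ μ.real Set.univ).eq_or_lt with h0 | h0
  · have hz : ∀ S, μ.real S = 0 := fun S =>
      le_antisymm (h0.symm ▸ measureReal_mono (Set.subset_univ S)) measureReal_nonneg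
    rw [hI, hW, ← h0]; simp [hz]
  · have := (mul_nonneg_iff_of_pos_left h0).1 h3
    linarith

/-! ### The hairbrush estimate -/

lemma xrayAdjoint_eq_sum_product {m : ℕ} (δ : ℝ) (E : Finset (EuclideanSpace ℝ (Fin m)))
    (g : EuclideanSpace ℝ (Fin m) → EuclideanSpace ℝ (Fin m) → ℝ)
    (x : EuclideanSpace ℝ (Fin m) × ℝ) :
    xrayAdjoint δ E g x =
      ∑ p ∈ E ×ˢ E, g p.1 p.2 * (kakeyaTube δ p.1 p.2).indicator (fun _ => (1 : ℝ)) x := by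
  rw [Finset.sum_product, xrayAdjoint]

lemma xrayAdjoint_nonneg {m : ℕ} {δ : ℝ} {E : Finset (EuclideanSpace ℝ (Fin m))}
    {g : EuclideanSpace ℝ (Fin m) → EuclideanSpace ℝ (Fin m) → ℝ} (hg : ∀ ω i, 0 ≤ g ω i)
    (x : EuclideanSpace ℝ (Fin m) × ℝ) : 0 ≤ xrayAdjoint δ E g x :=
  Finset.sum_nonneg fun _ _ => Finset.sum_nonneg fun _ _ =>
    mul_nonneg (hg _ _) (Set.indicator_nonneg (fun _ _ => zero_le_one) _)

lemma xrayAdjoint_le_sum {m : ℕ} {δ : ℝ} {E : Finset (EuclideanSpace ℝ (Fin m))}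
    {g : EuclideanSpace ℝ (Fin m) → EuclideanSpace ℝ (Fin m) → ℝ} (hg : ∀ ω i, 0 ≤ g ω i)
    (x : EuclideanSpace ℝ (Fin m) × ℝ) : xrayAdjoint δ E g x ≤ ∑ ω ∈ E, ∑ i ∈ E, g ω i :=
  Finset.sum_le_sum fun _ _ => Finset.sum_le_sum fun _ _ =>
    mul_le_of_le_one_right (hg _ _) (Set.indicator_le_self' (fun _ _ => zero_le_one) _)

lemma mul_measureReal_le_sum_inter {m : ℕ} {δ α : ℝ} {E : Finset (EuclideanSpace ℝ (Fin m))}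
    {f : EuclideanSpace ℝ (Fin m) → EuclideanSpace ℝ (Fin m) → ℝ}
    {Ω S : Set (EuclideanSpace ℝ (Fin m) × ℝ)} (hΩ : MeasurableSet Ω) (hfin : volume Ω < ⊤)
    (hα : ∀ x ∈ Ω, α ≤ xrayAdjoint δ E f x) :
    α * (volume.restrict Ω).real S ≤
      ∑ p ∈ E ×ˢ E, f p.1 p.2 * (volume.restrict Ω).real (kakeyaTube δ p.1 p.2 ∩ S) := by
  have hfinite : IsFiniteMeasure (volume.restrict Ω) := ⟨by simpa using hfin⟩
  set μ := volume.restrict Ω with hμ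
  have hint : ∀ p ∈ E ×ˢ E, Integrable (fun x => f p.1 p.2 *
      (kakeyaTube δ p.1 p.2).indicator (fun _ => (1 : ℝ)) x) (μ.restrict S) := fun p _ =>
    ((integrable_const _).indicator (measurableSet_kakeyaTube δ p.1 p.2)).const_mul _
  have h1 : ∑ p ∈ E ×ˢ E, f p.1 p.2 * μ.real (kakeyaTube δ p.1 p.2 ∩ S) =
      ∫ x, xrayAdjoint δ E f x ∂(μ.restrict S) := by
    simp only [xrayAdjoint_eq_sum_product]
    rw [integral_finsetSum _ hint]
    refine Finset.sum_congr rfl fun p _ => ?_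
    rw [integral_const_mul, integral_indicator_const _ (measurableSet_kakeyaTube δ p.1 p.2),
      measureReal_restrict_apply (measurableSet_kakeyaTube δ p.1 p.2), smul_eq_mul, mul_one]
  have h2 : α * μ.real S = ∫ _, α ∂(μ.restrict S) := by
    rw [integral_const, measureReal_restrict_apply MeasurableSet.univ, Set.univ_inter, smul_eq_mul,
      mul_comm]
  rw [h1, h2]
  refine integral_mono_ae (integrable_const _) ?_ ?_
  · rw [funext (xrayAdjoint_eq_sum_product δ E f)]
    exact integrable_finsetSum _ hint
  · exact ae_restrict_of_ae ((ae_restrict_iff' hΩ).2 (Filter.Eventually.of_forall hα))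

lemma measureReal_inter_kakeyaTube_le {m : ℕ} {δ : ℝ} (hδ : 0 < δ)
    (ω i ω' i' : EuclideanSpace ℝ (Fin m)) (Ω : Set (EuclideanSpace ℝ (Fin m) × ℝ))
    {S : Set (EuclideanSpace ℝ (Fin m) × ℝ)} (hS : S ⊆ kakeyaTube δ ω i ∩ kakeyaTube δ ω' i') :
    (volume.restrict Ω).real S ≤
      12 * unitBallVolume m * δ ^ (m + 1) * (1 / (‖ω - ω'‖ + δ)) := by
  refine (measureReal_restrict_le_of_subset_kakeyaTube hδ.le (l := 6 * δ / (‖ω - ω'‖ + δ))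
    (by positivity) (hS.trans Set.inter_subset_left)
    (fun p hp q hq => abs_sub_le_of_mem_inter_kakeyaTube hδ (hS hp) (hS hq)) Ω).trans_eq ?_
  rw [pow_succ]
  ring

/-- Córdoba's estimate for a hairbrush: outside the `ρ`-neighbourhood of the tube `T₀` that all
the tubes meet, a tube interacts only with those in a thin sector around its plane
through `T₀`. -/
lemma exists_hairbrush_overlap_le (m : ℕ) (hm : 1 ≤ m) : ∃ C : ℝ, 0 < C ∧
    ∀ δ : ℝ, 0 < δ → δ < 1 →
    ∀ E : Finset (EuclideanSpace ℝ (Fin m)), (∀ x ∈ E, x ∈ unitCube m) →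
    (∀ x ∈ E, ∀ y ∈ E, x ≠ y → δ ≤ dist x y) →
    ∀ g : EuclideanSpace ℝ (Fin m) → EuclideanSpace ℝ (Fin m) → ℝ, (∀ ω i, 0 ≤ g ω i) →
    ∀ A : ℝ, (∀ ω ∈ E, ∑ i ∈ E, g ω i ≤ A) →
    ∀ ρ : ℝ, 6 * δ ≤ ρ → ρ ≤ 24 * m →
    ∀ ω₀ ∈ E, ∀ i₀ : EuclideanSpace ℝ (Fin m),
    ∀ H ⊆ E ×ˢ E, (∀ p ∈ H, p.1 ≠ ω₀ ∧ (kakeyaTube δ ω₀ i₀ ∩ kakeyaTube δ p.1 p.2).Nonempty) →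
    ∀ Ω : Set (EuclideanSpace ℝ (Fin m) × ℝ), ∀ p' ∈ H,
      ∑ p ∈ H, g p.1 p.2 * (volume.restrict Ω).real
        (kakeyaTube δ p'.1 p'.2 ∩ {y | ρ < ‖y.1 - y.2 • ω₀ - i₀‖} ∩
          (kakeyaTube δ p.1 p.2 ∩ {y | ρ < ‖y.1 - y.2 • ω₀ - i₀‖})) ≤
      C * A * δ ^ m * (1 + Real.log (1 / δ)) * (ρ ^ (m - 1))⁻¹ := by
  classical
  obtain ⟨C, hC, hstrip⟩ := exists_sum_inv_dist_strip_le m hm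
  have hmR : (1 : ℝ) ≤ m := by exact_mod_cast hm
  have hv := unitBallVolume_pos m
  refine ⟨12 * unitBallVolume m * (C * (24 * m) ^ (m - 1)), by positivity, ?_⟩
  intro δ hδ hδ1 E hcube hsep g hg A hA ρ hρ hρ2 ω₀ hω₀ i₀ H hHE hH Ω p' hp'
  have hρ0 : 0 < ρ := by linarith
  have hmemE : ∀ p ∈ H, p.1 ∈ E ∧ p.2 ∈ E := fun p hp => Finset.mem_product.1 (hHE hp)
  have hA0 : 0 ≤ A :=
    (Finset.sum_nonneg fun i _ => hg ω₀ i).trans (hA ω₀ hω₀)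
  set S := E.filter fun ω => ∃ κ : ℝ, ‖(ω - ω₀) - κ • (p'.1 - ω₀)‖ ≤ 24 * m * δ / ρ with hS
  set D := 12 * unitBallVolume m * δ ^ (m + 1) with hD
  have hD0 : 0 < D := by positivity
  have hterm : ∀ p ∈ H, g p.1 p.2 * (volume.restrict Ω).real
        (kakeyaTube δ p'.1 p'.2 ∩ {y | ρ < ‖y.1 - y.2 • ω₀ - i₀‖} ∩
          (kakeyaTube δ p.1 p.2 ∩ {y | ρ < ‖y.1 - y.2 • ω₀ - i₀‖})) ≤
      if p.1 ∈ S then g p.1 p.2 * (D * (1 / (‖p.1 - p'.1‖ + δ))) else 0 := by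
    intro p hp
    set U := kakeyaTube δ p'.1 p'.2 ∩ {y | ρ < ‖y.1 - y.2 • ω₀ - i₀‖} ∩
          (kakeyaTube δ p.1 p.2 ∩ {y | ρ < ‖y.1 - y.2 • ω₀ - i₀‖}) with hU
    rcases U.eq_empty_or_nonempty with h0 | ⟨y, ⟨hy1, hy2⟩, hy3, -⟩
    · rw [h0, measureReal_empty, mul_zero]
      split_ifs
      · exact mul_nonneg (hg _ _) (by positivity)
      · exact le_rfl
    · rw [if_pos]
      · refine mul_le_mul_of_nonneg_left ?_ (hg _ _)
        exact measureReal_inter_kakeyaTube_le hδ p.1 p.2 p'.1 p'.2 Ω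
          fun z hz => ⟨hz.2.1, hz.1.1⟩
      · refine Finset.mem_filter.2 ⟨(hmemE p hp).1, ?_⟩
        exact exists_smul_sub_norm_le_of_hairbrush hm hδ hρ
          (norm_sub_le_of_mem_unitCube (hcube _ (hmemE p hp).1) (hcube _ hω₀))
          (hH p hp).2 (hH p' hp').2 hy3 hy1 hy2
  have hnn : ∀ p : EuclideanSpace ℝ (Fin m) × EuclideanSpace ℝ (Fin m),
      0 ≤ if p.1 ∈ S then g p.1 p.2 * (D * (1 / (‖p.1 - p'.1‖ + δ))) else 0 := by
    intro p
    split_ifs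
    · exact mul_nonneg (hg _ _) (by positivity)
    · exact le_rfl
  have hη : δ ≤ 24 * m * δ / ρ := by
    rw [le_div_iff₀ hρ0]; nlinarith
  have hsum := hstrip δ hδ hδ1 (24 * m * δ / ρ) hη S
    (fun x hx => hcube x (Finset.mem_filter.1 hx).1)
    (fun x hx y hy => hsep x (Finset.mem_filter.1 hx).1 y (Finset.mem_filter.1 hy).1)
    ω₀ p'.1 (hcube _ (hmemE p' hp').1) (hH p' hp').1 (fun ω hω => (Finset.mem_filter.1 hω).2)
  calc _ ≤ ∑ p ∈ H, if p.1 ∈ S then g p.1 p.2 * (D * (1 / (‖p.1 - p'.1‖ + δ))) else 0 :=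
        Finset.sum_le_sum hterm
    _ ≤ ∑ p ∈ E ×ˢ E, if p.1 ∈ S then g p.1 p.2 * (D * (1 / (‖p.1 - p'.1‖ + δ))) else 0 :=
        Finset.sum_le_sum_of_subset_of_nonneg hHE fun p _ _ => hnn p
    _ = ∑ ω ∈ E, if ω ∈ S then (∑ i ∈ E, g ω i) * (D * (1 / (‖ω - p'.1‖ + δ))) else 0 := by
        rw [Finset.sum_product]
        refine Finset.sum_congr rfl fun ω _ => ?_
        split_ifs
        · rw [Finset.sum_mul]
        · simp
    _ ≤ ∑ ω ∈ E, if ω ∈ S then A * (D * (1 / (‖ω - p'.1‖ + δ))) else 0 := by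
        refine Finset.sum_le_sum fun ω hω => ?_
        split_ifs
        · exact mul_le_mul_of_nonneg_right (hA ω hω) (by positivity)
        · exact le_rfl
    _ = A * D * ∑ ω ∈ S, 1 / (‖ω - p'.1‖ + δ) := by
        rw [← Finset.sum_filter, Finset.filter_mem_eq_inter,
          Finset.inter_eq_right.2 (Finset.filter_subset _ _), Finset.mul_sum]
        exact Finset.sum_congr rfl fun ω _ => by ring
    _ ≤ A * D * _ := mul_le_mul_of_nonneg_left hsum (by positivity)
    _ = _ := by
        have h1 : 24 * m * δ / ρ / δ = 24 * m * ρ⁻¹ := by field_simp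
        rw [h1, hD, pow_succ, mul_pow, inv_pow]
        field_simp

/-- The weak-type hairbrush estimate. A popular tube `T₀` of `f` is chosen among those meeting many
tubes of `g` that are richly filled by `Ω`; these tubes of `g` form a hairbrush with stem `T₀`,
whose tubes are essentially disjoint by `exists_hairbrush_overlap_le`. -/
lemma exists_hairbrush_weak_type (m : ℕ) (hm : 1 ≤ m) (c : ℝ) (hc : 0 < c) : ∃ C : ℝ, 0 < C ∧
    ∀ δ : ℝ, 0 < δ → δ < 1 →
    ∀ E : Finset (EuclideanSpace ℝ (Fin m)), (∀ x ∈ E, x ∈ unitCube m) →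
    (∀ x ∈ E, ∀ y ∈ E, x ≠ y → δ ≤ dist x y) →
    ∀ f g : EuclideanSpace ℝ (Fin m) → EuclideanSpace ℝ (Fin m) → ℝ,
    (∀ ω i, 0 ≤ f ω i) → (∀ ω i, 0 ≤ g ω i) →
    (∀ ω i ω' i', f ω i ≠ 0 → g ω' i' ≠ 0 → c ≤ dist ω ω') →
    ∀ A : ℝ, 0 ≤ A → (∀ ω ∈ E, ∑ i ∈ E, g ω i ≤ A) →
    ∀ Ω : Set (EuclideanSpace ℝ (Fin m) × ℝ), MeasurableSet Ω → volume Ω < ⊤ →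
    ∀ α β : ℝ, 0 ≤ α → 0 ≤ β → (∀ x ∈ Ω, α ≤ xrayAdjoint δ E f x) →
    (∀ x ∈ Ω, β ≤ xrayAdjoint δ E g x) →
      α * β ^ (m + 2) * (volume.real Ω) ^ (m + 1) ≤
        C * (1 + Real.log (1 / δ)) * (A * (∑ ω ∈ E, ∑ i ∈ E, f ω i) *
          (∑ ω ∈ E, ∑ i ∈ E, g ω i) ^ (m + 1)) * δ ^ (1 + (m + 1) * m) := by
  classical
  obtain ⟨C₁, hC₁, hover⟩ := exists_hairbrush_overlap_le m hm
  obtain ⟨C₂, hC₂, hcard⟩ := exists_card_le_of_separated m hm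
  have hmR : (1 : ℝ) ≤ m := by exact_mod_cast hm
  have hvm := unitBallVolume_pos m
  set vm := unitBallVolume m with hvmdef
  set c' := c / (16 * vm) with hc'
  have hc'0 : 0 < c' := by positivity
  refine ⟨(192 * vm / c) ^ (m + 1) * C₂ + 2 ^ (m + 1) * (96 * vm * C₁ / c * (c' ^ (m - 1))⁻¹),
    by positivity, ?_⟩
  intro δ hδ hδ1 E hcube hsep f g hf hg htrans A hA0 hA Ω hΩ hfin α β hα hβ hαu hβv
  have hlog : 0 ≤ Real.log (1 / δ) := Real.log_nonneg (by rw [le_div_iff₀ hδ]; linarith)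
  set L := 1 + Real.log (1 / δ) with hL
  have hL0 : 0 < L := by linarith
  set N₁ := ∑ ω ∈ E, ∑ i ∈ E, f ω i with hN₁
  set N₂ := ∑ ω ∈ E, ∑ i ∈ E, g ω i with hN₂
  have hN₁0 : 0 ≤ N₁ := Finset.sum_nonneg fun _ _ => Finset.sum_nonneg fun _ _ => hf _ _
  have hN₂0 : 0 ≤ N₂ := Finset.sum_nonneg fun _ _ => Finset.sum_nonneg fun _ _ => hg _ _
  set W := volume.real Ω with hW
  have hW0 : 0 ≤ W := measureReal_nonneg
  have hrhs : 0 ≤ ((192 * vm / c) ^ (m + 1) * C₂ +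
      2 ^ (m + 1) * (96 * vm * C₁ / c * (c' ^ (m - 1))⁻¹)) * L *
        (A * N₁ * N₂ ^ (m + 1)) * δ ^ (1 + (m + 1) * m) := by positivity
  rcases hα.eq_or_lt with rfl | hα0
  · simpa using hrhs
  rcases hβ.eq_or_lt with rfl | hβ0
  · simpa using hrhs
  rcases hW0.eq_or_lt with hW' | hWpos
  · rw [← hW']; simpa using hrhs
  obtain ⟨x₀, hx₀⟩ : Ω.Nonempty := by
    rw [Set.nonempty_iff_ne_empty]
    intro h0
    rw [hW, h0, measureReal_empty] at hWpos
    exact lt_irrefl _ hWpos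
  have hαN : α ≤ N₁ := (hαu x₀ hx₀).trans (xrayAdjoint_le_sum hf x₀)
  have hβN : β ≤ N₂ := (hβv x₀ hx₀).trans (xrayAdjoint_le_sum hg x₀)
  have hN₁p : 0 < N₁ := hα0.trans_le hαN
  have hN₂p : 0 < N₂ := hβ0.trans_le hβN
  have hfinite : IsFiniteMeasure (volume.restrict Ω) := ⟨by simpa using hfin⟩
  set μ := volume.restrict Ω with hμ
  have hμuniv : μ.real Set.univ = W := by
    rw [hμ, measureReal_restrict_apply MeasurableSet.univ, Set.univ_inter]
  set T : EuclideanSpace ℝ (Fin m) × EuclideanSpace ℝ (Fin m) →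
    Set (EuclideanSpace ℝ (Fin m) × ℝ) := fun p => kakeyaTube δ p.1 p.2 with hT
  have hTm : ∀ p, MeasurableSet (T p) := fun p => measurableSet_kakeyaTube δ p.1 p.2
  -- half the average density of `Ω` along the tubes of `g`
  set lam := β * W / (2 * N₂ * δ ^ m) with hlam
  have hlam0 : 0 < lam := by positivity
  have hlamδ : lam * δ ^ m * N₂ = β * W / 2 := by rw [hlam]; field_simp
  have hβW : β * W = 2 * N₂ * δ ^ m * lam := by rw [hlam]; field_simp
  set ρ := c' * lam with hρ
  have hρ0 : 0 < ρ := by positivity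
  have hsplit : α * β ^ (m + 2) * W ^ (m + 1) = α * β * (β * W) ^ (m + 1) := by
    rw [mul_pow]; ring
  rw [hsplit]
  rcases lt_or_ge ρ (6 * δ) with hsmall | hlarge
  · -- the density is too small for a hairbrush, and counting directions suffices
    have h1 : β * W ≤ 192 * vm / c * (N₂ * δ ^ (m + 1)) := by
      have h2 : lam ≤ 96 * vm / c * δ := by
        have h3 : lam = 16 * vm / c * ρ := by rw [hρ, hc']; field_simp
        rw [h3]
        calc _ ≤ 16 * vm / c * (6 * δ) := by gcongr
          _ = _ := by ring
      calc _ = 2 * N₂ * δ ^ m * lam := hβW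
        _ ≤ 2 * N₂ * δ ^ m * (96 * vm / c * δ) := by gcongr
        _ = _ := by rw [pow_succ]; ring
    have h4 : N₂ ≤ A * (C₂ * (δ ^ m)⁻¹ * L) := by
      have h5 : N₂ ≤ E.card • A := Finset.sum_le_card_nsmul _ _ _ hA
      rw [nsmul_eq_mul, mul_comm] at h5
      exact h5.trans (mul_le_mul_of_nonneg_left (hcard δ hδ hδ1 E hcube hsep) hA0)
    calc α * β * (β * W) ^ (m + 1)
        ≤ N₁ * (A * (C₂ * (δ ^ m)⁻¹ * L)) * (192 * vm / c * (N₂ * δ ^ (m + 1))) ^ (m + 1) := by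
          gcongr
          exact hβN.trans h4
      _ = (192 * vm / c) ^ (m + 1) * C₂ * L * (A * N₁ * N₂ ^ (m + 1)) * δ ^ (1 + (m + 1) * m) := by
          have h6 : (δ ^ (m + 1)) ^ (m + 1) = δ ^ m * δ ^ (1 + (m + 1) * m) := by
            rw [← pow_mul, ← pow_add]; congr 1; ring
          rw [mul_pow, mul_pow, h6]
          field_simp
      _ ≤ _ := by
          gcongr
          exact le_add_of_nonneg_right (by positivity)
  · have hgood0 := mul_measureReal_le_sum_inter (f := g) hΩ hfin (S := Set.univ) hβv
    simp only [Set.inter_univ] at hgood0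
    rw [← hμ, hμuniv] at hgood0
    set G := (E ×ˢ E).filter fun p => lam * δ ^ m ≤ μ.real (T p) with hG
    have hgood : β * W / 2 ≤ ∑ p ∈ G, g p.1 p.2 * μ.real (T p) := by
      rw [← Finset.sum_filter_add_sum_filter_not (E ×ˢ E)
        (fun p => lam * δ ^ m ≤ μ.real (T p))] at hgood0
      have hbad : ∑ p ∈ (E ×ˢ E).filter (fun p => ¬ lam * δ ^ m ≤ μ.real (T p)),
          g p.1 p.2 * μ.real (T p) ≤ β * W / 2 := by
        calc _ ≤ ∑ p ∈ (E ×ˢ E).filter (fun p => ¬ lam * δ ^ m ≤ μ.real (T p)),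
              g p.1 p.2 * (lam * δ ^ m) := by
              refine Finset.sum_le_sum fun p hp => ?_
              exact mul_le_mul_of_nonneg_left (not_le.1 (Finset.mem_filter.1 hp).2).le (hg _ _)
          _ ≤ ∑ p ∈ E ×ˢ E, g p.1 p.2 * (lam * δ ^ m) :=
              Finset.sum_le_sum_of_subset_of_nonneg (Finset.filter_subset _ _)
                fun p _ _ => mul_nonneg (hg _ _) (by positivity)
          _ = β * W / 2 := by
              rw [← Finset.sum_mul, Finset.sum_product, ← hN₂, ← hlamδ]; ring
      linarith
    set X : EuclideanSpace ℝ (Fin m) × EuclideanSpace ℝ (Fin m) → ℝ := fun q =>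
      ∑ p ∈ G, g p.1 p.2 * μ.real (T q ∩ T p) with hX
    have hdouble : α * β * W / 2 ≤ ∑ q ∈ E ×ˢ E, f q.1 q.2 * X q := by
      calc α * β * W / 2 = α * (β * W / 2) := by ring
        _ ≤ α * ∑ p ∈ G, g p.1 p.2 * μ.real (T p) := by gcongr
        _ = ∑ p ∈ G, g p.1 p.2 * (α * μ.real (T p)) := by
            rw [Finset.mul_sum]; exact Finset.sum_congr rfl fun p _ => by ring
        _ ≤ ∑ p ∈ G, g p.1 p.2 * ∑ q ∈ E ×ˢ E, f q.1 q.2 * μ.real (T q ∩ T p) :=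
            Finset.sum_le_sum fun p _ => mul_le_mul_of_nonneg_left
              (mul_measureReal_le_sum_inter hΩ hfin hαu) (hg _ _)
        _ = _ := by
            simp only [hX, Finset.mul_sum]
            rw [Finset.sum_comm]
            exact Finset.sum_congr rfl fun q _ => Finset.sum_congr rfl fun p _ => by ring
    obtain ⟨q, hqE, hfq, hXq⟩ : ∃ q ∈ E ×ˢ E, f q.1 q.2 ≠ 0 ∧ α * β * W / (2 * N₁) ≤ X q := by
      have h1 : ∑ q ∈ (E ×ˢ E).filter (fun q => f q.1 q.2 ≠ 0),
          f q.1 q.2 * (α * β * W / (2 * N₁)) ≤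
          ∑ q ∈ (E ×ˢ E).filter (fun q => f q.1 q.2 ≠ 0), f q.1 q.2 * X q := by
        rw [Finset.sum_filter_of_ne (fun q _ h => left_ne_zero_of_mul h),
          Finset.sum_filter_of_ne (fun q _ h => left_ne_zero_of_mul h), ← Finset.sum_mul,
          Finset.sum_product, ← hN₁]
        refine le_trans (le_of_eq ?_) hdouble
        field_simp
      have h2 : ((E ×ˢ E).filter (fun q => f q.1 q.2 ≠ 0)).Nonempty := by
        rw [Finset.nonempty_iff_ne_empty]
        intro h0
        have h3 : N₁ = ∑ q ∈ (E ×ˢ E).filter (fun q => f q.1 q.2 ≠ 0), f q.1 q.2 := by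
          rw [Finset.sum_filter_of_ne (fun q _ h => h), Finset.sum_product]
        rw [h0, Finset.sum_empty] at h3
        exact hN₁p.ne' h3
      obtain ⟨q, hq, hle⟩ := Finset.exists_le_of_sum_le h2 h1
      obtain ⟨hqE, hfq⟩ := Finset.mem_filter.1 hq
      exact ⟨q, hqE, hfq, le_of_mul_le_mul_left hle (lt_of_le_of_ne (hf _ _) (Ne.symm hfq))⟩
    set H := G.filter fun p => g p.1 p.2 ≠ 0 ∧ (T q ∩ T p).Nonempty with hH
    set M := ∑ p ∈ H, g p.1 p.2 with hM
    have hq1 : q.1 ∈ E := (Finset.mem_product.1 hqE).1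
    have hHE : H ⊆ E ×ˢ E := (Finset.filter_subset _ _).trans (Finset.filter_subset _ _)
    have hHc : ∀ p ∈ H, c ≤ ‖p.1 - q.1‖ := by
      intro p hp
      rw [← dist_eq_norm, dist_comm]
      exact htrans _ _ _ _ hfq (Finset.mem_filter.1 hp).2.1
    have hXM : X q ≤ M * (12 * vm * δ ^ (m + 1) / c) := by
      have h1 : X q = ∑ p ∈ H, g p.1 p.2 * μ.real (T q ∩ T p) := by
        rw [hH, Finset.sum_filter_of_ne]
        intro p _ h
        refine ⟨left_ne_zero_of_mul h, ?_⟩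
        rw [Set.nonempty_iff_ne_empty]
        intro h0
        rw [h0, measureReal_empty, mul_zero] at h
        exact h rfl
      rw [h1, hM, Finset.sum_mul]
      refine Finset.sum_le_sum fun p hp => mul_le_mul_of_nonneg_left ?_ (hg _ _)
      refine (measureReal_inter_kakeyaTube_le hδ p.1 p.2 q.1 q.2 Ω
        (S := T q ∩ T p) fun z hz => ⟨hz.2, hz.1⟩).trans ?_
      rw [mul_one_div]
      have := hHc p hp
      gcongr
      linarith
    have hMlow : α * β * W / (2 * N₁) ≤ M * (12 * vm * δ ^ (m + 1) / c) := hXq.trans hXM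
    have hMpos : 0 < M := by
      have h1 : 0 < M * (12 * vm * δ ^ (m + 1) / c) := lt_of_lt_of_le (by positivity) hMlow
      exact pos_of_mul_pos_left h1 (by positivity)
    obtain ⟨p₁, hp₁⟩ : H.Nonempty := by
      rw [Finset.nonempty_iff_ne_empty]
      intro h0
      rw [hM, h0, Finset.sum_empty] at hMpos
      exact lt_irrefl _ hMpos
    have hHlam : ∀ p ∈ H, lam * δ ^ m ≤ μ.real (T p) := fun p hp =>
      (Finset.mem_filter.1 (Finset.mem_filter.1 hp).1).2
    have hρle : ρ ≤ 24 * m := by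
      have h1 : lam * δ ^ m ≤ vm * δ ^ m * (2 * 2) :=
        (hHlam p₁ hp₁).trans (measureReal_restrict_le_of_subset_kakeyaTube hδ.le (by norm_num)
          subset_rfl (fun y hy z hz => (abs_sub _ _).trans (by linarith [hy.1, hz.1])) Ω)
      have h2 : lam ≤ 4 * vm := by
        have h3 : 0 < δ ^ m := by positivity
        have h4 : lam * δ ^ m ≤ (4 * vm) * δ ^ m := by linarith
        exact le_of_mul_le_mul_right h4 h3
      have h5 : c ≤ 2 * m := (hHc p₁ hp₁).trans (norm_sub_le_of_mem_unitCube
        (hcube _ (Finset.mem_product.1 (hHE hp₁)).1) (hcube _ hq1))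
      calc ρ ≤ c' * (4 * vm) := by rw [hρ]; gcongr
        _ = c / 4 := by rw [hc']; field_simp; norm_num
        _ ≤ 24 * m := by linarith
    set K : Set (EuclideanSpace ℝ (Fin m) × ℝ) := {y | ρ < ‖y.1 - y.2 • q.1 - q.2‖} with hK
    have hKm : MeasurableSet K :=
      (isOpen_lt (by fun_prop) (by fun_prop)).measurableSet
    -- removing the `ρ`-neighbourhood of the stem costs each tube at most half of its share
    have hTK : ∀ p ∈ H, lam * δ ^ m / 2 ≤ μ.real (T p ∩ K) := by
      intro p hp
      have h1 : μ.real (T p) ≤ μ.real (T p ∩ K) + μ.real (T p ∩ Kᶜ) := by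
        refine le_trans (le_of_eq ?_) (measureReal_union_le _ _)
        rw [Set.inter_union_compl]
      have h2 : μ.real (T p ∩ Kᶜ) ≤ vm * δ ^ m * (2 * (2 * (ρ + δ) / c)) := by
        refine measureReal_restrict_le_of_subset_kakeyaTube hδ.le (by positivity)
          Set.inter_subset_left (fun y hy z hz => ?_) Ω
        exact abs_sub_le_of_mem_neighbourhood hc (hHc p hp) hy.1 (not_lt.1 hy.2) hz.1
          (not_lt.1 hz.2)
      have h3 : vm * δ ^ m * (2 * (2 * (ρ + δ) / c)) ≤ lam * δ ^ m / 2 := by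
        calc _ ≤ vm * δ ^ m * (2 * (2 * (ρ + ρ) / c)) := by gcongr; linarith
          _ = _ := by rw [hρ, hc']; field_simp; norm_num
      linarith [hHlam p hp]
    have hCS := sq_sum_measureReal_le μ H (fun p => g p.1 p.2) (fun p => T p ∩ K)
      fun p _ => (hTm p).inter hKm
    set Z := C₁ * A * δ ^ m * L * (ρ ^ (m - 1))⁻¹ with hZ
    have hZ0 : ∑ p ∈ H, ∑ k ∈ H, g p.1 p.2 * g k.1 k.2 * μ.real (T p ∩ K ∩ (T k ∩ K)) ≤ M * Z := by
      rw [hM, Finset.sum_mul]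
      refine Finset.sum_le_sum fun p hp => ?_
      simp only [mul_assoc (g p.1 p.2)]
      rw [← Finset.mul_sum]
      refine mul_le_mul_of_nonneg_left ?_ (hg _ _)
      refine hover δ hδ hδ1 E hcube hsep g hg A hA ρ hlarge hρle q.1 hq1 q.2 H hHE ?_ Ω p hp
      intro k hk
      refine ⟨?_, (Finset.mem_filter.1 hk).2.2⟩
      intro h0
      have := hHc k hk
      rw [h0, sub_self, norm_zero] at this
      linarith
    have hlow : M * (lam * δ ^ m / 2) ≤ ∑ p ∈ H, g p.1 p.2 * μ.real (T p ∩ K) := by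
      rw [hM, Finset.sum_mul]
      exact Finset.sum_le_sum fun p hp => mul_le_mul_of_nonneg_left (hTK p hp) (hg _ _)
    have hMup : M * (lam * δ ^ m / 2) ^ 2 ≤ W * Z := by
      have h1 : (M * (lam * δ ^ m / 2)) ^ 2 ≤ W * (M * Z) := by
        rw [hμuniv] at hCS
        exact (pow_le_pow_left₀ (by positivity) hlow 2).trans
          (hCS.trans (mul_le_mul_of_nonneg_left hZ0 hW0))
      have h2 : M * (M * (lam * δ ^ m / 2) ^ 2) ≤ M * (W * Z) := by
        calc _ = (M * (lam * δ ^ m / 2)) ^ 2 := by ring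
          _ ≤ _ := h1
          _ = _ := by ring
      exact le_of_mul_le_mul_left h2 hMpos
    have hfinal : α * β * lam ^ (m + 1) ≤
        96 * vm * C₁ / c * (c' ^ (m - 1))⁻¹ * (N₁ * A * L * δ) := by
      have h1 : α * β * W / (2 * N₁) * (lam * δ ^ m / 2) ^ 2 ≤
          W * Z * (12 * vm * δ ^ (m + 1) / c) := by
        calc _ ≤ M * (12 * vm * δ ^ (m + 1) / c) * (lam * δ ^ m / 2) ^ 2 := by gcongr
          _ = M * (lam * δ ^ m / 2) ^ 2 * (12 * vm * δ ^ (m + 1) / c) := by ring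
          _ ≤ _ := by gcongr
      have h2 : lam ^ (m + 1) = lam ^ (m - 1) * lam ^ 2 := by
        rw [← pow_add]; congr 1; omega
      have h3 : α * β * lam ^ (m + 1) = (α * β * W / (2 * N₁) * (lam * δ ^ m / 2) ^ 2) *
          (8 * N₁ * lam ^ (m - 1) / (W * (δ ^ m) ^ 2)) := by
        rw [h2]; field_simp; norm_num
      rw [h3]
      refine (mul_le_mul_of_nonneg_right h1 (by positivity)).trans_eq ?_
      rw [hZ, hρ, mul_pow, pow_succ δ m]
      field_simp
      ring_nf
    calc α * β * (β * W) ^ (m + 1) = (2 * N₂ * δ ^ m) ^ (m + 1) * (α * β * lam ^ (m + 1)) := by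
          rw [hβW, mul_pow _ lam]; ring
      _ ≤ (2 * N₂ * δ ^ m) ^ (m + 1) *
          (96 * vm * C₁ / c * (c' ^ (m - 1))⁻¹ * (N₁ * A * L * δ)) := by gcongr
      _ = 2 ^ (m + 1) * (96 * vm * C₁ / c * (c' ^ (m - 1))⁻¹) * L * (A * N₁ * N₂ ^ (m + 1)) *
          δ ^ (1 + (m + 1) * m) := by
          rw [mul_pow, mul_pow, ← pow_mul, pow_add δ 1, mul_comm m (m + 1)]; ring
      _ ≤ _ := by
          gcongr
          exact le_add_of_nonneg_left (by positivity)

/-! ### From weak type to strong type -/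

/-- The weak-type estimate with the roles of `f` and `g` averaged. -/
lemma exists_symmetric_weak_type (m : ℕ) (hm : 1 ≤ m) (c : ℝ) (hc : 0 < c) : ∃ C : ℝ, 0 < C ∧
    ∀ δ : ℝ, 0 < δ → δ < 1 →
    ∀ E : Finset (EuclideanSpace ℝ (Fin m)), (∀ x ∈ E, x ∈ unitCube m) →
    (∀ x ∈ E, ∀ y ∈ E, x ≠ y → δ ≤ dist x y) →
    ∀ f g : EuclideanSpace ℝ (Fin m) → EuclideanSpace ℝ (Fin m) → ℝ,
    (∀ ω i, 0 ≤ f ω i) → (∀ ω i, 0 ≤ g ω i) →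
    (∀ ω i ω' i', f ω i ≠ 0 → g ω' i' ≠ 0 → c ≤ dist ω ω') →
    ∀ A B : ℝ, 0 ≤ A → 0 ≤ B → (∀ ω ∈ E, ∑ i ∈ E, f ω i ≤ A) → (∀ ω ∈ E, ∑ i ∈ E, g ω i ≤ B) →
    ∀ Ω : Set (EuclideanSpace ℝ (Fin m) × ℝ), MeasurableSet Ω → volume Ω < ⊤ →
    ∀ α β : ℝ, 0 ≤ α → 0 ≤ β → (∀ x ∈ Ω, α ≤ xrayAdjoint δ E f x) →
    (∀ x ∈ Ω, β ≤ xrayAdjoint δ E g x) →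
      (α * β) ^ (((m : ℝ) + 3) / (2 * (m + 1))) * volume.real Ω ≤
        (C * (1 + Real.log (1 / δ))) *
        ((A * (∑ ω ∈ E, ∑ i ∈ E, f ω i) ^ (m + 2)) *
          (B * (∑ ω ∈ E, ∑ i ∈ E, g ω i) ^ (m + 2))) ^ (1 / (2 * ((m : ℝ) + 1))) *
          δ ^ ((1 + (m + 1) * m) / ((m : ℝ) + 1)) := by
  obtain ⟨C, hC, h⟩ := exists_hairbrush_weak_type m hm c hc
  have hm0 : (0 : ℝ) ≤ m := Nat.cast_nonneg m
  refine ⟨max C 1, by positivity, ?_⟩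
  intro δ hδ hδ1 E hcube hsep f g hf hg htrans A B hA0 hB0 hA hB Ω hΩ hfin α β hα hβ hu hv
  have h1 := h δ hδ hδ1 E hcube hsep f g hf hg htrans B hB0 hB Ω hΩ hfin α β hα hβ hu hv
  have h2 := h δ hδ hδ1 E hcube hsep g f hg hf
    (fun ω i ω' i' hgi hfi => by rw [dist_comm]; exact htrans _ _ _ _ hfi hgi)
    A hA0 hA Ω hΩ hfin β α hβ hα hv hu
  have hlog : 0 ≤ Real.log (1 / δ) := Real.log_nonneg (by rw [le_div_iff₀ hδ]; linarith)
  set L := 1 + Real.log (1 / δ) with hL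
  have hL1 : 1 ≤ L := by linarith
  set N₁ := ∑ ω ∈ E, ∑ i ∈ E, f ω i with hN₁
  set N₂ := ∑ ω ∈ E, ∑ i ∈ E, g ω i with hN₂
  have hN₁0 : 0 ≤ N₁ := Finset.sum_nonneg fun _ _ => Finset.sum_nonneg fun _ _ => hf _ _
  have hN₂0 : 0 ≤ N₂ := Finset.sum_nonneg fun _ _ => Finset.sum_nonneg fun _ _ => hg _ _
  set W := volume.real Ω with hW
  have hW0 : 0 ≤ W := measureReal_nonneg
  set C' := max C 1 with hC'
  have hCC : C ≤ C' := le_max_left _ _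
  have hC1 : 1 ≤ C' := le_max_right _ _
  have hCL : 1 ≤ C' * L := by nlinarith
  set XY := (A * N₁ ^ (m + 2)) * (B * N₂ ^ (m + 2)) with hXY
  have hXY0 : 0 ≤ XY := by positivity
  set D := δ ^ (1 + (m + 1) * m) with hD
  have hD0 : 0 ≤ D := by positivity
  set s : ℝ := 1 / (2 * ((m : ℝ) + 1)) with hs
  have hs0 : 0 < s := by positivity
  have hmul : (α * β) ^ (m + 3) * W ^ (2 * (m + 1)) ≤ (C' * L) ^ 2 * XY * D ^ 2 := by
    have h3 := mul_le_mul h1 h2 (by positivity) (by positivity)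
    calc (α * β) ^ (m + 3) * W ^ (2 * (m + 1))
        = α * β ^ (m + 2) * W ^ (m + 1) * (β * α ^ (m + 2) * W ^ (m + 1)) := by ring
      _ ≤ _ := h3
      _ = (C * L) ^ 2 * XY * D ^ 2 := by rw [hXY]; ring
      _ ≤ _ := by gcongr
  have hroot := Real.rpow_le_rpow (by positivity) hmul hs0.le
  have e1 : ((α * β) ^ (m + 3) * W ^ (2 * (m + 1))) ^ s =
      (α * β) ^ (((m : ℝ) + 3) / (2 * (m + 1))) * W := by
    rw [Real.mul_rpow (by positivity) (by positivity), ← Real.rpow_natCast, ← Real.rpow_natCast,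
      ← Real.rpow_mul (by positivity), ← Real.rpow_mul hW0]
    have a1 : ((m + 3 : ℕ) : ℝ) * s = ((m : ℝ) + 3) / (2 * (m + 1)) := by
      rw [hs]; push_cast; field_simp
    have a2 : ((2 * (m + 1) : ℕ) : ℝ) * s = 1 := by rw [hs]; push_cast; field_simp
    rw [a1, a2, Real.rpow_one]
  have e2 : (D ^ 2) ^ s = δ ^ ((1 + (m + 1) * m) / ((m : ℝ) + 1)) := by
    rw [hD, ← pow_mul, ← Real.rpow_natCast, ← Real.rpow_mul hδ.le]
    congr 1
    rw [hs]; push_cast; field_simp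
  have e3 : ((C' * L) ^ 2) ^ s ≤ C' * L := by
    rw [← Real.rpow_natCast, ← Real.rpow_mul (by positivity)]
    refine (Real.rpow_le_rpow_of_exponent_le hCL ?_).trans_eq (Real.rpow_one _)
    rw [hs]; push_cast
    rw [mul_one_div, div_le_one (by positivity)]
    linarith
  have e4 : ((C' * L) ^ 2 * XY * D ^ 2) ^ s = ((C' * L) ^ 2) ^ s * XY ^ s * (D ^ 2) ^ s := by
    rw [Real.mul_rpow (by positivity) (by positivity), Real.mul_rpow (by positivity) hXY0]
  rw [e1, e4, e2] at hroot
  refine hroot.trans ?_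
  gcongr

lemma exists_geometric_level {q N u : ℝ} (J : ℕ) (hl : q ^ J * N < u) (hu : u ≤ N) :
    ∃ j < J, q ^ (j + 1) * N ≤ u ∧ u ≤ q ^ j * N := by
  induction J with
  | zero => simp at hl; linarith
  | succ J ih =>
    rcases lt_or_ge (q ^ J * N) u with h | h
    · obtain ⟨j, hj, hj'⟩ := ih h
      exact ⟨j, hj.trans (Nat.lt_succ_self J), hj'⟩
    · exact ⟨J, Nat.lt_succ_self J, hl.le, h⟩

lemma measurable_xrayAdjoint {m : ℕ} (δ : ℝ) (E : Finset (EuclideanSpace ℝ (Fin m)))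
    (g : EuclideanSpace ℝ (Fin m) → EuclideanSpace ℝ (Fin m) → ℝ) :
    Measurable (xrayAdjoint δ E g) := by
  refine Finset.measurable_fun_sum _ fun ω _ => Finset.measurable_fun_sum _ fun i _ => ?_
  exact (measurable_const.indicator (measurableSet_kakeyaTube δ ω i)).const_mul _

/-- A bounded set containing all tubes with directions and bases in the cube. -/
def tubeRegion (m : ℕ) : Set (EuclideanSpace ℝ (Fin m) × ℝ) :=
  Metric.closedBall 0 (2 * m + 1) ×ˢ Set.Icc (-1) 1

lemma measurableSet_tubeRegion (m : ℕ) : MeasurableSet (tubeRegion m) :=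
  measurableSet_closedBall.prod measurableSet_Icc

lemma volume_tubeRegion_lt_top (m : ℕ) : volume (tubeRegion m) < ⊤ :=
  ((isCompact_closedBall _ _).prod isCompact_Icc).measure_lt_top

lemma norm_le_of_mem_unitCube {m : ℕ} {x : EuclideanSpace ℝ (Fin m)} (hx : x ∈ unitCube m) :
    ‖x‖ ≤ m := by
  refine (EuclideanSpace.norm_le_sum_abs _).trans ?_
  refine (Finset.sum_le_sum fun l _ => hx l).trans ?_
  simp

lemma xrayAdjoint_eq_zero_of_notMem {m : ℕ} {δ : ℝ} (hδ1 : δ < 1)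
    {E : Finset (EuclideanSpace ℝ (Fin m))} (hcube : ∀ x ∈ E, x ∈ unitCube m)
    (g : EuclideanSpace ℝ (Fin m) → EuclideanSpace ℝ (Fin m) → ℝ)
    {x : EuclideanSpace ℝ (Fin m) × ℝ} (hx : x ∉ tubeRegion m) : xrayAdjoint δ E g x = 0 := by
  refine Finset.sum_eq_zero fun ω hω => Finset.sum_eq_zero fun i hi => ?_
  rw [Set.indicator_of_notMem, mul_zero]
  rintro ⟨h1, h2⟩
  refine hx ⟨?_, abs_le.1 h1⟩
  rw [mem_closedBall_zero_iff]
  have e : x.1 = (x.1 - x.2 • ω - i) + x.2 • ω + i := by module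
  have a1 := norm_add_le ((x.1 - x.2 • ω - i) + x.2 • ω) i
  have a2 := norm_add_le (x.1 - x.2 • ω - i) (x.2 • ω)
  have a3 : ‖x.2 • ω‖ ≤ 1 * m := by
    rw [norm_smul, Real.norm_eq_abs]
    exact mul_le_mul h1 (norm_le_of_mem_unitCube (hcube ω hω)) (norm_nonneg _) zero_le_one
  have a4 := norm_le_of_mem_unitCube (hcube i hi)
  rw [← e] at a1
  linarith

lemma exists_card_le_inv_pow (m : ℕ) (hm : 1 ≤ m) : ∃ C : ℝ, 0 < C ∧
    ∀ δ : ℝ, 0 < δ → δ < 1 →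
    ∀ S : Finset (EuclideanSpace ℝ (Fin m)), (∀ x ∈ S, x ∈ unitCube m) →
    (∀ x ∈ S, ∀ y ∈ S, x ≠ y → δ ≤ dist x y) →
    (S.card : ℝ) ≤ C * (δ ^ (m + 1))⁻¹ := by
  obtain ⟨C, hC, h⟩ := exists_card_le_of_separated m hm
  refine ⟨C, hC, fun δ hδ hδ1 S hcube hsep => (h δ hδ hδ1 S hcube hsep).trans ?_⟩
  have h1 : 1 + Real.log (1 / δ) ≤ δ⁻¹ := by
    have := Real.log_le_sub_one_of_pos (x := 1 / δ) (by positivity)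
    rw [one_div] at this ⊢
    linarith
  calc _ ≤ C * (δ ^ m)⁻¹ * δ⁻¹ := by gcongr
    _ = _ := by rw [pow_succ, mul_inv]; ring

lemma exists_one_add_log_le (ε : ℝ) (hε : 0 < ε) : ∃ C : ℝ, 0 < C ∧
    ∀ δ : ℝ, 0 < δ → δ < 1 → 1 + Real.log (1 / δ) ≤ C * δ ^ (-ε) := by
  refine ⟨1 + 1 / ε, by positivity, fun δ hδ hδ1 => ?_⟩
  have h1 := Real.log_le_rpow_div (x := 1 / δ) (by positivity) hε
  have h2 : (1 / δ) ^ ε = δ ^ (-ε) := by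
    rw [one_div, Real.inv_rpow hδ.le, Real.rpow_neg hδ.le]
  have h3 : 1 ≤ δ ^ (-ε) := Real.one_le_rpow_of_pos_of_le_one_of_nonpos hδ hδ1.le (by linarith)
  rw [h2] at h1
  calc _ ≤ δ ^ (-ε) + δ ^ (-ε) / ε := by linarith
    _ = _ := by ring

/-- Strong-type estimate in terms of the sup norm and the `ℓ¹` norm in `ω`. The weak-type bound is
summed over the levels of `X*f` and `X*g`, in powers of a small power of `δ`, so that their number
does not depend on `δ`. -/
lemma exists_lintegral_rpow_le_of_sup_le (m : ℕ) (hm : 1 ≤ m) (c : ℝ) (hc : 0 < c)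
    (ε : ℝ) (hε : 0 < ε) : ∃ C : ℝ, 0 < C ∧
    ∀ δ : ℝ, 0 < δ → δ < 1 →
    ∀ E : Finset (EuclideanSpace ℝ (Fin m)), (∀ x ∈ E, x ∈ unitCube m) →
    (∀ x ∈ E, ∀ y ∈ E, x ≠ y → δ ≤ dist x y) →
    ∀ f g : EuclideanSpace ℝ (Fin m) → EuclideanSpace ℝ (Fin m) → ℝ,
    (∀ ω i, 0 ≤ f ω i) → (∀ ω i, 0 ≤ g ω i) →
    (∀ ω i ω' i', f ω i ≠ 0 → g ω' i' ≠ 0 → c ≤ dist ω ω') →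
    ∀ A B : ℝ, 0 ≤ A → 0 ≤ B → (∀ ω ∈ E, ∑ i ∈ E, f ω i ≤ A) → (∀ ω ∈ E, ∑ i ∈ E, g ω i ≤ B) →
      ∫⁻ x, ENNReal.ofReal ((xrayAdjoint δ E f x * xrayAdjoint δ E g x) ^
        (((m : ℝ) + 3) / (2 * (m + 1)))) ≤
      ENNReal.ofReal (C * δ ^ (-ε) *
        (((A * (∑ ω ∈ E, ∑ i ∈ E, f ω i) ^ (m + 2)) *
          (B * (∑ ω ∈ E, ∑ i ∈ E, g ω i) ^ (m + 2))) ^ (1 / (2 * ((m : ℝ) + 1))) *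
          δ ^ ((1 + (m + 1) * m) / ((m : ℝ) + 1)))) := by
  obtain ⟨C₁, hC₁, hweak⟩ := exists_symmetric_weak_type m hm c hc
  obtain ⟨C₂, hC₂, hcard⟩ := exists_card_le_inv_pow m hm
  obtain ⟨C₃, hC₃, hlogle⟩ := exists_one_add_log_le (ε / 2) (by positivity)
  have hm1 : (1 : ℝ) ≤ m := by exact_mod_cast hm
  set r : ℝ := ((m : ℝ) + 3) / (2 * (m + 1)) with hr
  set s : ℝ := 1 / (2 * ((m : ℝ) + 1)) with hs
  set d : ℝ := (1 + (m + 1) * m) / ((m : ℝ) + 1) with hd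
  have hr0 : 0 < r := by positivity
  have hs0 : 0 < s := by positivity
  have hr1 : r ≤ 1 := by rw [hr, div_le_one (by positivity)]; linarith
  have hr2 : 1 / 2 ≤ r := by rw [hr, div_le_div_iff₀ (by positivity) (by positivity)]; linarith
  have hdle : d ≤ m + 1 := by rw [hd, div_le_iff₀ (by positivity)]; nlinarith
  have hrs : r = (m + 3) * s := by rw [hr, hs]; ring
  set η := ε / 4 with hη
  have hη0 : 0 < η := by positivity
  obtain ⟨J, hJ⟩ := exists_nat_ge ((2 * m + 4) / η)
  rw [div_le_iff₀ hη0] at hJ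
  set V := volume.real (tubeRegion m) with hV
  have hV0 : 0 ≤ V := measureReal_nonneg
  refine ⟨J * J * (C₁ * C₃) + V * C₂ ^ (2 * s) + 1, by positivity, ?_⟩
  intro δ hδ hδ1 E hcube hsep f g hf hg htrans A B hA0 hB0 hA hB
  set u := xrayAdjoint δ E f with hu
  set v := xrayAdjoint δ E g with hv
  have hu0 : ∀ x, 0 ≤ u x := xrayAdjoint_nonneg hf
  have hv0 : ∀ x, 0 ≤ v x := xrayAdjoint_nonneg hg
  set N₁ := ∑ ω ∈ E, ∑ i ∈ E, f ω i with hN₁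
  set N₂ := ∑ ω ∈ E, ∑ i ∈ E, g ω i with hN₂
  have huN : ∀ x, u x ≤ N₁ := xrayAdjoint_le_sum hf
  have hvN : ∀ x, v x ≤ N₂ := xrayAdjoint_le_sum hg
  have hN₁0 : 0 ≤ N₁ := Finset.sum_nonneg fun _ _ => Finset.sum_nonneg fun _ _ => hf _ _
  have hN₂0 : 0 ≤ N₂ := Finset.sum_nonneg fun _ _ => Finset.sum_nonneg fun _ _ => hg _ _
  set XY := (A * N₁ ^ (m + 2)) * (B * N₂ ^ (m + 2)) with hXY
  have hXY0 : 0 ≤ XY := by positivity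
  set q := δ ^ η with hq
  have hq0 : 0 < q := Real.rpow_pos_of_pos hδ _
  have hq1 : q ≤ 1 := Real.rpow_le_one hδ.le hδ1.le hη0.le
  set T := XY ^ s * δ ^ d with hT
  have hT0 : 0 ≤ T := by positivity
  set R := tubeRegion m with hR
  set Ω : ℕ → ℕ → Set (EuclideanSpace ℝ (Fin m) × ℝ) := fun j k =>
    R ∩ {x | q ^ (j + 1) * N₁ ≤ u x ∧ q ^ (k + 1) * N₂ ≤ v x} with hΩ
  have hum : Measurable u := measurable_xrayAdjoint δ E f
  have hvm : Measurable v := measurable_xrayAdjoint δ E g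
  have hΩm : ∀ j k, MeasurableSet (Ω j k) := fun j k =>
    (measurableSet_tubeRegion m).inter
      ((measurableSet_le measurable_const hum).inter (measurableSet_le measurable_const hvm))
  have hΩfin : ∀ j k, volume (Ω j k) < ⊤ := fun j k =>
    (measure_mono Set.inter_subset_left).trans_lt (volume_tubeRegion_lt_top m)
  -- the bound for `(X*f X*g)^r` on the level set `Ω j k`
  set a : ℕ → ℕ → ℝ := fun j k =>
    (q ^ 2)⁻¹ * ((q ^ (j + 1) * N₁) * (q ^ (k + 1) * N₂)) ^ r with ha
  have ha0 : ∀ j k, 0 ≤ a j k := fun j k => by positivity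
  set b : ℝ := (q ^ J * (N₁ * N₂)) ^ r with hb
  have hb0 : 0 ≤ b := by positivity
  have hpt : ∀ x, ENNReal.ofReal ((u x * v x) ^ r) ≤
      ∑ j ∈ Finset.range J, ∑ k ∈ Finset.range J,
        (Ω j k).indicator (fun _ => ENNReal.ofReal (a j k)) x +
      R.indicator (fun _ => ENNReal.ofReal b) x := by
    intro x
    by_cases hx : x ∈ R
    · by_cases hlev : q ^ J * N₁ < u x ∧ q ^ J * N₂ < v x
      · obtain ⟨j, hj, hj1, hj2⟩ := exists_geometric_level J hlev.1 (huN x)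
        obtain ⟨k, hk, hk1, hk2⟩ := exists_geometric_level J hlev.2 (hvN x)
        have hxΩ : x ∈ Ω j k := ⟨hx, hj1, hk1⟩
        have h1 : (u x * v x) ^ r ≤ a j k := by
          have h2 : u x * v x ≤
              (q ^ 2)⁻¹ * ((q ^ (j + 1) * N₁) * (q ^ (k + 1) * N₂)) := by
            calc u x * v x ≤ (q ^ j * N₁) * (q ^ k * N₂) :=
                  mul_le_mul hj2 hk2 (hv0 x) (by positivity)
              _ = _ := by field_simp; ring
          have h3 : ((q ^ 2)⁻¹) ^ r ≤ (q ^ 2)⁻¹ := by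
            refine (Real.rpow_le_rpow_of_exponent_le ?_ hr1).trans_eq (Real.rpow_one _)
            exact (one_le_inv₀ (by positivity)).2 (pow_le_one₀ hq0.le hq1)
          calc _ ≤ ((q ^ 2)⁻¹ * ((q ^ (j + 1) * N₁) * (q ^ (k + 1) * N₂))) ^ r :=
                Real.rpow_le_rpow (mul_nonneg (hu0 x) (hv0 x)) h2 hr0.le
            _ = ((q ^ 2)⁻¹) ^ r * ((q ^ (j + 1) * N₁) * (q ^ (k + 1) * N₂)) ^ r :=
                Real.mul_rpow (by positivity) (by positivity)
            _ ≤ _ := mul_le_mul_of_nonneg_right h3 (by positivity)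
        refine le_trans ?_ le_self_add
        refine le_trans ?_ (Finset.single_le_sum (fun _ _ => zero_le) (Finset.mem_range.2 hj))
        refine le_trans ?_ (Finset.single_le_sum (fun _ _ => zero_le) (Finset.mem_range.2 hk))
        rw [Set.indicator_of_mem hxΩ]
        exact ENNReal.ofReal_le_ofReal h1
      · refine le_trans ?_ le_add_self
        rw [Set.indicator_of_mem hx]
        apply ENNReal.ofReal_le_ofReal
        refine Real.rpow_le_rpow (mul_nonneg (hu0 x) (hv0 x)) ?_ hr0.le
        rw [not_and_or, not_lt, not_lt] at hlev
        rcases hlev with h | h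
        · calc _ ≤ q ^ J * N₁ * N₂ := mul_le_mul h (hvN x) (hv0 x) (by positivity)
            _ = _ := by ring
        · calc _ ≤ N₁ * (q ^ J * N₂) := mul_le_mul (huN x) h (hv0 x) hN₁0
            _ = _ := by ring
    · have h0 : u x = 0 := xrayAdjoint_eq_zero_of_notMem hδ1 hcube f hx
      rw [h0, zero_mul, Real.zero_rpow hr0.ne', ENNReal.ofReal_zero]
      exact zero_le
  have hterm : ∀ j k, a j k * volume.real (Ω j k) ≤ C₁ * C₃ * δ ^ (-ε) * T := by
    intro j k
    have h1 := hweak δ hδ hδ1 E hcube hsep f g hf hg htrans A B hA0 hB0 hA hB (Ω j k) (hΩm j k)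
      (hΩfin j k) (q ^ (j + 1) * N₁) (q ^ (k + 1) * N₂) (by positivity) (by positivity)
      (fun x hx => hx.2.1) (fun x hx => hx.2.2)
    have h2 : (q ^ 2)⁻¹ * δ ^ (-(ε / 2)) = δ ^ (-ε) := by
      rw [hq, ← Real.rpow_natCast, ← Real.rpow_mul hδ.le, ← Real.rpow_neg hδ.le,
        ← Real.rpow_add hδ]
      congr 1
      rw [hη]; push_cast; ring
    calc a j k * volume.real (Ω j k) = (q ^ 2)⁻¹ *
          (((q ^ (j + 1) * N₁) * (q ^ (k + 1) * N₂)) ^ r * volume.real (Ω j k)) := by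
          rw [ha]; ring
      _ ≤ (q ^ 2)⁻¹ * (C₁ * (C₃ * δ ^ (-(ε / 2))) * XY ^ s * δ ^ d) := by
          refine mul_le_mul_of_nonneg_left (h1.trans ?_) (by positivity)
          gcongr
          exact hlogle δ hδ hδ1
      _ = C₁ * C₃ * ((q ^ 2)⁻¹ * δ ^ (-(ε / 2))) * T := by rw [hT]; ring
      _ = _ := by rw [h2]
  have hrem : b ≤ C₂ ^ (2 * s) * T := by
    have hNA : ∀ (N' A' : ℝ), 0 ≤ N' → N' ≤ E.card • A' → 0 ≤ A' →
        N' ^ (m + 3) * δ ^ (m + 1) ≤ C₂ * (A' * N' ^ (m + 2)) := by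
      intro N' A' hN' h hA'
      rw [nsmul_eq_mul] at h
      have h1 := mul_le_mul_of_nonneg_right (hcard δ hδ hδ1 E hcube hsep) hA'
      have h2 : N' * δ ^ (m + 1) ≤ C₂ * A' := by
        calc _ ≤ (C₂ * (δ ^ (m + 1))⁻¹ * A') * δ ^ (m + 1) := by
              gcongr
              exact h.trans h1
          _ = _ := by field_simp
      calc _ = N' ^ (m + 2) * (N' * δ ^ (m + 1)) := by ring
        _ ≤ N' ^ (m + 2) * (C₂ * A') := by gcongr
        _ = _ := by ring
    have h1 := hNA N₁ A hN₁0 (Finset.sum_le_card_nsmul _ _ _ hA) hA0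
    have h2 := hNA N₂ B hN₂0 (Finset.sum_le_card_nsmul _ _ _ hB) hB0
    have h3 : (N₁ * N₂) ^ (m + 3) * δ ^ (2 * (m + 1)) ≤ C₂ ^ 2 * XY := by
      have := mul_le_mul h1 h2 (by positivity) (by positivity)
      calc _ = N₁ ^ (m + 3) * δ ^ (m + 1) * (N₂ ^ (m + 3) * δ ^ (m + 1)) := by ring
        _ ≤ _ := this
        _ = _ := by rw [hXY]; ring
    have h4 : (N₁ * N₂) ^ r * δ ≤ C₂ ^ (2 * s) * XY ^ s := by
      have h5 := Real.rpow_le_rpow (by positivity) h3 hs0.le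
      rw [Real.mul_rpow (by positivity) (by positivity), Real.mul_rpow (by positivity) hXY0,
        ← Real.rpow_natCast, ← Real.rpow_natCast, ← Real.rpow_natCast,
        ← Real.rpow_mul (by positivity), ← Real.rpow_mul (by positivity),
        ← Real.rpow_mul (by positivity)] at h5
      have e1 : ((m + 3 : ℕ) : ℝ) * s = r := by rw [hrs]; push_cast; ring
      have e2 : ((2 * (m + 1) : ℕ) : ℝ) * s = 1 := by rw [hs]; push_cast; field_simp
      have e3 : ((2 : ℕ) : ℝ) * s = 2 * s := by push_cast; ring
      rw [e1, e2, e3, Real.rpow_one] at h5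
      exact h5
    have h6 : (q ^ J) ^ r ≤ δ * δ ^ d := by
      rw [hq, ← Real.rpow_natCast, ← Real.rpow_mul hδ.le, ← Real.rpow_mul hδ.le]
      have : δ * δ ^ d = δ ^ (1 + d) := by rw [Real.rpow_add hδ, Real.rpow_one]
      rw [this]
      apply Real.rpow_le_rpow_of_exponent_ge hδ hδ1.le
      have h7 : (2 * m + 4) * (1 / 2) ≤ η * J * r := by
        rw [mul_comm η]
        gcongr
      linarith
    calc b = (q ^ J) ^ r * (N₁ * N₂) ^ r := by rw [hb, Real.mul_rpow (by positivity) (by positivity)]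
      _ ≤ (δ * δ ^ d) * (N₁ * N₂) ^ r := by gcongr
      _ = ((N₁ * N₂) ^ r * δ) * δ ^ d := by ring
      _ ≤ (C₂ ^ (2 * s) * XY ^ s) * δ ^ d := by gcongr
      _ = _ := by rw [hT]; ring
  have hδε : 1 ≤ δ ^ (-ε) :=
    Real.one_le_rpow_of_pos_of_le_one_of_nonpos hδ hδ1.le (by linarith)
  calc ∫⁻ x, ENNReal.ofReal ((u x * v x) ^ r)
      ≤ ∫⁻ x, (∑ j ∈ Finset.range J, ∑ k ∈ Finset.range J,
        (Ω j k).indicator (fun _ => ENNReal.ofReal (a j k)) x +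
        R.indicator (fun _ => ENNReal.ofReal b) x) := lintegral_mono hpt
    _ = ∑ j ∈ Finset.range J, ∑ k ∈ Finset.range J, ENNReal.ofReal (a j k) * volume (Ω j k) +
        ENNReal.ofReal b * volume R := by
        have hind : ∀ j k, Measurable ((Ω j k).indicator fun _ => ENNReal.ofReal (a j k)) :=
          fun j k => measurable_const.indicator (hΩm j k)
        rw [lintegral_add_right _ (measurable_const.indicator (measurableSet_tubeRegion m)),
          lintegral_finsetSum _ fun j _ => Finset.measurable_fun_sum _ fun k _ => hind j k,
          lintegral_indicator_const (measurableSet_tubeRegion m)]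
        congr 1
        refine Finset.sum_congr rfl fun j _ => ?_
        rw [lintegral_finsetSum _ fun k _ => hind j k]
        exact Finset.sum_congr rfl fun k _ => lintegral_indicator_const (hΩm j k) _
    _ = ENNReal.ofReal (∑ j ∈ Finset.range J, ∑ k ∈ Finset.range J,
          a j k * volume.real (Ω j k) + b * V) := by
        have hnn : ∀ j k, 0 ≤ a j k * volume.real (Ω j k) := fun j k =>
          mul_nonneg (ha0 j k) measureReal_nonneg
        rw [ENNReal.ofReal_add (Finset.sum_nonneg fun j _ => Finset.sum_nonneg fun k _ => hnn j k)
          (by positivity), ENNReal.ofReal_sum_of_nonneg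
          (fun j _ => Finset.sum_nonneg fun k _ => hnn j k), ENNReal.ofReal_mul hb0, hV,
          ofReal_measureReal (volume_tubeRegion_lt_top m).ne]
        congr 1
        refine Finset.sum_congr rfl fun j _ => ?_
        rw [ENNReal.ofReal_sum_of_nonneg fun k _ => hnn j k]
        refine Finset.sum_congr rfl fun k _ => ?_
        rw [ENNReal.ofReal_mul (ha0 j k), ofReal_measureReal (hΩfin j k).ne]
    _ ≤ _ := by
        apply ENNReal.ofReal_le_ofReal
        calc _ ≤ ∑ j ∈ Finset.range J, ∑ k ∈ Finset.range J, C₁ * C₃ * δ ^ (-ε) * T +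
              C₂ ^ (2 * s) * T * V := by
              refine add_le_add (Finset.sum_le_sum fun j _ => Finset.sum_le_sum fun k _ =>
                hterm j k) (mul_le_mul_of_nonneg_right hrem hV0)
          _ = J * J * (C₁ * C₃) * δ ^ (-ε) * T + V * C₂ ^ (2 * s) * 1 * T := by
              simp only [Finset.sum_const, Finset.card_range, nsmul_eq_mul]; ring
          _ ≤ J * J * (C₁ * C₃) * δ ^ (-ε) * T + V * C₂ ^ (2 * s) * δ ^ (-ε) * T +
              δ ^ (-ε) * T := by
              have : 0 ≤ δ ^ (-ε) * T := by positivity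
              have h8 : V * C₂ ^ (2 * s) * 1 * T ≤ V * C₂ ^ (2 * s) * δ ^ (-ε) * T := by gcongr
              linarith
          _ = _ := by ring

/-! ### Decomposition by the size of the functions, and the endpoint estimate -/

/-- Decomposition of `f` according to the size of `F ω = ∑ i, f ω i`. A function taking a single
nonzero value satisfies `‖F‖_∞ ‖F‖₁^(m+2) = ‖F‖_a^(m+3)` with `a = (m+3)/(m+2)`; each piece satisfies
this as an inequality, up to the ratio `q` of consecutive levels. The last piece collects the values
below all levels, and is controlled through the number of directions. -/
lemma exists_level_decomposition {m : ℕ} {q K : ℝ} (hq0 : 0 < q) (hq1 : q ≤ 1) (hK : 1 ≤ K)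
    (J : ℕ) {E : Finset (EuclideanSpace ℝ (Fin m))} (hJ : q ^ J * E.card ≤ K)
    {f : EuclideanSpace ℝ (Fin m) → EuclideanSpace ℝ (Fin m) → ℝ} (hf : ∀ ω i, 0 ≤ f ω i) :
    ∃ (φ : ℕ → EuclideanSpace ℝ (Fin m) → EuclideanSpace ℝ (Fin m) → ℝ) (A : ℕ → ℝ),
      (∀ j ω i, 0 ≤ φ j ω i) ∧ (∀ j ω i, φ j ω i ≠ 0 → f ω i ≠ 0) ∧ (∀ j, 0 ≤ A j) ∧
      (∀ j, ∀ ω ∈ E, ∑ i ∈ E, φ j ω i ≤ A j) ∧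
      (∀ j, A j * (∑ ω ∈ E, ∑ i ∈ E, φ j ω i) ^ (m + 2) ≤ K ^ (m + 2) * q⁻¹ *
        (∑ ω ∈ E, (∑ i ∈ E, f ω i) ^ (((m : ℝ) + 3) / (m + 2))) ^ (m + 2)) ∧
      (∀ ω ∈ E, ∀ i, f ω i ≤ ∑ j ∈ Finset.range (J + 1), φ j ω i) := by
  classical
  set a : ℝ := ((m : ℝ) + 3) / (m + 2) with ha
  have ha0 : 0 < a := by positivity
  set F : EuclideanSpace ℝ (Fin m) → ℝ := fun ω => ∑ i ∈ E, f ω i with hF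
  have hF0 : ∀ ω, 0 ≤ F ω := fun ω => Finset.sum_nonneg fun i _ => hf ω i
  set S := ∑ ω ∈ E, F ω ^ a with hS
  have hS0 : 0 ≤ S := Finset.sum_nonneg fun ω _ => Real.rpow_nonneg (hF0 ω) _
  set Φ := S ^ a⁻¹ with hΦ
  have hΦ0 : 0 ≤ Φ := Real.rpow_nonneg hS0 _
  have hFΦ : ∀ ω ∈ E, F ω ≤ Φ := by
    intro ω hω
    rw [hΦ, Real.le_rpow_inv_iff_of_pos (hF0 ω) hS0 ha0]
    exact Finset.single_le_sum (f := fun ω => F ω ^ a)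
      (fun ω _ => Real.rpow_nonneg (hF0 ω) _) hω
  have hΦS : Φ ^ (m + 3) = S ^ (m + 2) := by
    rw [hΦ, ← Real.rpow_natCast, ← Real.rpow_mul hS0, ← Real.rpow_natCast]
    congr 1
    rw [ha]; push_cast; field_simp
  set P : ℕ → EuclideanSpace ℝ (Fin m) → Prop := fun j ω =>
    (j < J → q ^ (j + 1) * Φ ≤ F ω) ∧ F ω ≤ q ^ j * Φ with hP
  set φ : ℕ → EuclideanSpace ℝ (Fin m) → EuclideanSpace ℝ (Fin m) → ℝ := fun j ω i =>
    if j ≤ J ∧ P j ω then f ω i else 0 with hφ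
  have hφ0 : ∀ j ω i, 0 ≤ φ j ω i := by
    intro j ω i
    simp only [hφ]
    split_ifs
    · exact hf ω i
    · exact le_rfl
  have hφsum : ∀ j ω, ∑ i ∈ E, φ j ω i = if j ≤ J ∧ P j ω then F ω else 0 := by
    intro j ω
    simp only [hφ, hF]
    split_ifs <;> simp
  have hAφ : ∀ j ω, ∑ i ∈ E, φ j ω i ≤ q ^ j * Φ := by
    intro j ω
    rw [hφsum]
    split_ifs with h
    · exact h.2.2
    · positivity
  refine ⟨φ, fun j => q ^ j * Φ, hφ0, ?_, fun j => by positivity, fun j ω _ => hAφ j ω, ?_, ?_⟩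
  · intro j ω i h h0
    apply h
    simp [hφ, h0]
  · intro j
    set N := ∑ ω ∈ E, ∑ i ∈ E, φ j ω i with hN
    have hN0 : 0 ≤ N := Finset.sum_nonneg fun ω _ => Finset.sum_nonneg fun i _ => hφ0 j ω i
    have hKq : 1 ≤ K ^ (m + 2) := one_le_pow₀ hK
    have hqinv : 1 ≤ q⁻¹ := (one_le_inv₀ hq0).2 hq1
    rcases lt_trichotomy j J with hj | hj | hj
    · -- on a level, `F` is comparable with `q ^ j * Φ`
      have h1 : (q ^ (j + 1) * Φ) ^ (1 / ((m : ℝ) + 2)) * N ≤ S := by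
        rw [hN, Finset.mul_sum]
        refine Finset.sum_le_sum fun ω _ => ?_
        rw [hφsum]
        split_ifs with h
        · have e : a = 1 / ((m : ℝ) + 2) + 1 := by rw [ha]; field_simp; ring
          rw [e, Real.rpow_add_of_nonneg (hF0 ω) (by positivity) zero_le_one, Real.rpow_one]
          refine mul_le_mul_of_nonneg_right ?_ (hF0 ω)
          exact Real.rpow_le_rpow (by positivity) (h.2.1 hj) (by positivity)
        · rw [mul_zero]; exact Real.rpow_nonneg (hF0 ω) _
      have h2 := pow_le_pow_left₀ (by positivity) h1 (m + 2)
      rw [mul_pow, ← Real.rpow_natCast, ← Real.rpow_mul (by positivity)] at h2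
      have e2 : 1 / ((m : ℝ) + 2) * ((m + 2 : ℕ) : ℝ) = 1 := by push_cast; field_simp
      rw [e2, Real.rpow_one] at h2
      calc q ^ j * Φ * N ^ (m + 2) = q⁻¹ * (q ^ (j + 1) * Φ * N ^ (m + 2)) := by
            field_simp; ring
        _ ≤ q⁻¹ * S ^ (m + 2) := by gcongr
        _ ≤ K ^ (m + 2) * (q⁻¹ * S ^ (m + 2)) := le_mul_of_one_le_left (by positivity) hKq
        _ = _ := by ring
    · -- below all levels, counting directions suffices
      subst hj
      have h1 : N ≤ K * Φ := by
        have h2 : N ≤ E.card • (q ^ j * Φ) := Finset.sum_le_card_nsmul _ _ _ fun ω _ => hAφ j ω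
        rw [nsmul_eq_mul] at h2
        calc N ≤ _ := h2
          _ = q ^ j * E.card * Φ := by ring
          _ ≤ _ := by gcongr
      calc q ^ j * Φ * N ^ (m + 2) ≤ 1 * Φ * (K * Φ) ^ (m + 2) := by
            gcongr
            exact pow_le_one₀ hq0.le hq1
        _ = K ^ (m + 2) * 1 * Φ ^ (m + 3) := by ring
        _ ≤ K ^ (m + 2) * q⁻¹ * Φ ^ (m + 3) := by gcongr
        _ = _ := by rw [hΦS]
    · have h0 : N = 0 := by
        refine Finset.sum_eq_zero fun ω _ => ?_
        rw [hφsum, if_neg]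
        exact fun h => absurd h.1 (not_le.2 hj)
      rw [h0, zero_pow (by omega), mul_zero]
      positivity
  · intro ω hω i
    have hcov : ∃ j ≤ J, P j ω := by
      rcases lt_or_ge (q ^ J * Φ) (F ω) with h | h
      · obtain ⟨j, hj, h1, h2⟩ := exists_geometric_level J h (hFΦ ω hω)
        exact ⟨j, hj.le, fun _ => h1, h2⟩
      · exact ⟨J, le_rfl, fun h => absurd h (lt_irrefl _), h⟩
    obtain ⟨j, hj, hPj⟩ := hcov
    have h1 : φ j ω i = f ω i := if_pos ⟨hj, hPj⟩
    rw [← h1]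
    exact Finset.single_le_sum (f := fun j => φ j ω i) (fun j _ => hφ0 j ω i)
      (Finset.mem_range.2 (Nat.lt_succ_of_le hj))

lemma xrayAdjoint_le_sum_of_le_sum {m : ℕ} {δ : ℝ} {E : Finset (EuclideanSpace ℝ (Fin m))}
    {f : EuclideanSpace ℝ (Fin m) → EuclideanSpace ℝ (Fin m) → ℝ} {s : Finset ℕ}
    {φ : ℕ → EuclideanSpace ℝ (Fin m) → EuclideanSpace ℝ (Fin m) → ℝ}
    (h : ∀ ω ∈ E, ∀ i, f ω i ≤ ∑ j ∈ s, φ j ω i) (x : EuclideanSpace ℝ (Fin m) × ℝ) :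
    xrayAdjoint δ E f x ≤ ∑ j ∈ s, xrayAdjoint δ E (φ j) x := by
  simp only [xrayAdjoint_eq_sum_product]
  rw [Finset.sum_comm (s := s)]
  refine Finset.sum_le_sum fun p hp => ?_
  rw [← Finset.sum_mul]
  exact mul_le_mul_of_nonneg_right (h p.1 (Finset.mem_product.1 hp).1 p.2)
    (Set.indicator_nonneg (fun _ _ => zero_le_one) _)

/-- Subadditivity of `t ↦ t ^ r`, `r ≤ 1`, for a product of two finite sums. -/
lemma ofReal_mul_rpow_le_sum {s : Finset ℕ} {r U V : ℝ} {u v : ℕ → ℝ} (hr0 : 0 < r) (hr1 : r ≤ 1)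
    (hu : ∀ j, 0 ≤ u j) (hv : ∀ j, 0 ≤ v j) (hU : 0 ≤ U) (hV : 0 ≤ V)
    (hUu : U ≤ ∑ j ∈ s, u j) (hVv : V ≤ ∑ j ∈ s, v j) :
    ENNReal.ofReal ((U * V) ^ r) ≤
      ∑ j ∈ s, ∑ k ∈ s, ENNReal.ofReal ((u j * v k) ^ r) := by
  have hsub : ∀ t : ℕ → ENNReal, (∑ j ∈ s, t j) ^ r ≤ ∑ j ∈ s, t j ^ r := fun t =>
    Finset.le_sum_of_subadditive (fun y : ENNReal => y ^ r) (ENNReal.zero_rpow_of_pos hr0).le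
      (fun x y => ENNReal.rpow_add_le_add_rpow x y hr0.le hr1) s t
  have h1 : U * V ≤ ∑ j ∈ s, ∑ k ∈ s, u j * v k := by
    rw [← Finset.sum_mul_sum]
    exact mul_le_mul hUu hVv hV (hU.trans hUu)
  have hnn : ∀ j k, 0 ≤ u j * v k := fun j k => mul_nonneg (hu j) (hv k)
  rw [← ENNReal.ofReal_rpow_of_nonneg (mul_nonneg hU hV) hr0.le]
  calc ENNReal.ofReal (U * V) ^ r
      ≤ (∑ j ∈ s, ∑ k ∈ s, ENNReal.ofReal (u j * v k)) ^ r := by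
        refine ENNReal.rpow_le_rpow ?_ hr0.le
        refine (ENNReal.ofReal_le_ofReal h1).trans_eq ?_
        rw [ENNReal.ofReal_sum_of_nonneg fun j _ => Finset.sum_nonneg fun k _ => hnn j k]
        exact Finset.sum_congr rfl fun j _ => ENNReal.ofReal_sum_of_nonneg fun k _ => hnn j k
    _ ≤ ∑ j ∈ s, ∑ k ∈ s, ENNReal.ofReal (u j * v k) ^ r :=
        (hsub _).trans (Finset.sum_le_sum fun j _ => hsub _)
    _ = _ := Finset.sum_congr rfl fun j _ => Finset.sum_congr rfl fun k _ =>
        ENNReal.ofReal_rpow_of_nonneg (hnn j k) hr0.le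

/-- The estimate of the theorem, raised to the power `r` and with unnormalized sums in `ω`. -/
lemma exists_lintegral_rpow_le (m : ℕ) (hm : 1 ≤ m) (c : ℝ) (hc : 0 < c)
    (ε : ℝ) (hε : 0 < ε) : ∃ C : ℝ, 0 < C ∧
    ∀ δ : ℝ, 0 < δ → δ < 1 →
    ∀ E : Finset (EuclideanSpace ℝ (Fin m)), (∀ x ∈ E, x ∈ unitCube m) →
    (∀ x ∈ E, ∀ y ∈ E, x ≠ y → δ ≤ dist x y) →
    ∀ f g : EuclideanSpace ℝ (Fin m) → EuclideanSpace ℝ (Fin m) → ℝ,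
    (∀ ω i, 0 ≤ f ω i) → (∀ ω i, 0 ≤ g ω i) →
    (∀ ω i ω' i', f ω i ≠ 0 → g ω' i' ≠ 0 → c ≤ dist ω ω') →
      ∫⁻ x, ENNReal.ofReal ((xrayAdjoint δ E f x * xrayAdjoint δ E g x) ^
        (((m : ℝ) + 3) / (2 * (m + 1)))) ≤
      ENNReal.ofReal (C * δ ^ (-ε) *
        (((∑ ω ∈ E, (∑ i ∈ E, f ω i) ^ (((m : ℝ) + 3) / (m + 2))) *
          (∑ ω ∈ E, (∑ i ∈ E, g ω i) ^ (((m : ℝ) + 3) / (m + 2)))) ^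
            (((m : ℝ) + 2) / (2 * (m + 1))) *
          δ ^ ((1 + (m + 1) * m) / ((m : ℝ) + 1)))) := by
  have hε3 : 0 < ε / 3 := by positivity
  obtain ⟨C₁, hC₁, hmain⟩ := exists_lintegral_rpow_le_of_sup_le m hm c hc (ε / 3) hε3
  obtain ⟨C₂, hC₂, hcard⟩ := exists_card_le_inv_pow m hm
  have hm1 : (1 : ℝ) ≤ m := by exact_mod_cast hm
  set r : ℝ := ((m : ℝ) + 3) / (2 * (m + 1)) with hr
  set s : ℝ := 1 / (2 * ((m : ℝ) + 1)) with hs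
  set d : ℝ := (1 + (m + 1) * m) / ((m : ℝ) + 1) with hd
  set a : ℝ := ((m : ℝ) + 3) / (m + 2) with ha
  have hr0 : 0 < r := by positivity
  have hs0 : 0 < s := by positivity
  have hs1 : s ≤ 1 := by rw [hs, div_le_one (by positivity)]; linarith
  have hr1 : r ≤ 1 := by rw [hr, div_le_one (by positivity)]; linarith
  obtain ⟨J, hJ⟩ := exists_nat_ge ((m + 1) / (ε / 3))
  rw [div_le_iff₀ hε3] at hJ
  set K := max C₂ 1 with hK
  have hK1 : 1 ≤ K := le_max_right _ _
  refine ⟨(J + 1) * (J + 1) * (C₁ * (K ^ (m + 2)) ^ 2), by positivity, ?_⟩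
  intro δ hδ hδ1 E hcube hsep f g hf hg htrans
  set q := δ ^ (ε / 3) with hq
  have hq0 : 0 < q := Real.rpow_pos_of_pos hδ _
  have hq1 : q ≤ 1 := Real.rpow_le_one hδ.le hδ1.le hε3.le
  have hqJ : q ^ J * E.card ≤ K := by
    have h1 : q ^ J ≤ δ ^ (m + 1) := by
      rw [hq, ← Real.rpow_natCast, ← Real.rpow_mul hδ.le, ← Real.rpow_natCast]
      apply Real.rpow_le_rpow_of_exponent_ge hδ hδ1.le
      push_cast
      linarith
    calc q ^ J * E.card ≤ δ ^ (m + 1) * (C₂ * (δ ^ (m + 1))⁻¹) := by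
          gcongr
          exact hcard δ hδ hδ1 E hcube hsep
      _ = C₂ := by field_simp
      _ ≤ K := le_max_left _ _
  obtain ⟨φ, A, hφ0, hφf, hA0, hφA, hAS, hfφ⟩ :=
    exists_level_decomposition hq0 hq1 hK1 J hqJ hf
  obtain ⟨ψ, B, hψ0, hψg, hB0, hψB, hBS, hgψ⟩ :=
    exists_level_decomposition hq0 hq1 hK1 J hqJ hg
  set Sf := ∑ ω ∈ E, (∑ i ∈ E, f ω i) ^ a with hSf
  set Sg := ∑ ω ∈ E, (∑ i ∈ E, g ω i) ^ a with hSg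
  have hSf0 : 0 ≤ Sf := Finset.sum_nonneg fun ω _ =>
    Real.rpow_nonneg (Finset.sum_nonneg fun i _ => hf ω i) _
  have hSg0 : 0 ≤ Sg := Finset.sum_nonneg fun ω _ =>
    Real.rpow_nonneg (Finset.sum_nonneg fun i _ => hg ω i) _
  set Q := C₁ * δ ^ (-(ε / 3)) * ((K ^ (m + 2)) ^ 2 * (q ^ 2)⁻¹ *
    (Sf * Sg) ^ (((m : ℝ) + 2) / (2 * (m + 1))) * δ ^ d) with hQ
  have hQ0 : 0 ≤ Q := by positivity
  have hpiece : ∀ j k, ∫⁻ x, ENNReal.ofReal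
      ((xrayAdjoint δ E (φ j) x * xrayAdjoint δ E (ψ k) x) ^ r) ≤ ENNReal.ofReal Q := by
    intro j k
    refine (hmain δ hδ hδ1 E hcube hsep (φ j) (ψ k) (hφ0 j) (hψ0 k)
      (fun ω i ω' i' h h' => htrans ω i ω' i' (hφf j ω i h) (hψg k ω' i' h'))
      (A j) (B k) (hA0 j) (hB0 k) (hφA j) (hψB k)).trans ?_
    apply ENNReal.ofReal_le_ofReal
    have hN₁ : 0 ≤ ∑ ω ∈ E, ∑ i ∈ E, φ j ω i :=
      Finset.sum_nonneg fun _ _ => Finset.sum_nonneg fun _ _ => hφ0 _ _ _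
    have hN₂ : 0 ≤ ∑ ω ∈ E, ∑ i ∈ E, ψ k ω i :=
      Finset.sum_nonneg fun _ _ => Finset.sum_nonneg fun _ _ => hψ0 _ _ _
    have hXY := mul_le_mul (hAS j) (hBS k) (mul_nonneg (hB0 k) (by positivity)) (by positivity)
    have h1 := Real.rpow_le_rpow (mul_nonneg (mul_nonneg (hA0 j) (by positivity))
      (mul_nonneg (hB0 k) (by positivity))) hXY hs0.le
    have e1 : K ^ (m + 2) * q⁻¹ * Sf ^ (m + 2) * (K ^ (m + 2) * q⁻¹ * Sg ^ (m + 2)) =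
        ((K ^ (m + 2)) ^ 2 * (q ^ 2)⁻¹) * (Sf * Sg) ^ (m + 2) := by
      rw [mul_pow, ← inv_pow]; ring
    have h2 : ((K ^ (m + 2)) ^ 2 * (q ^ 2)⁻¹) ^ s ≤ (K ^ (m + 2)) ^ 2 * (q ^ 2)⁻¹ := by
      refine (Real.rpow_le_rpow_of_exponent_le ?_ hs1).trans_eq (Real.rpow_one _)
      exact one_le_mul_of_one_le_of_one_le (one_le_pow₀ (one_le_pow₀ hK1))
        ((one_le_inv₀ (by positivity)).2 (pow_le_one₀ hq0.le hq1))
    have e2 : ((Sf * Sg) ^ (m + 2)) ^ s = (Sf * Sg) ^ (((m : ℝ) + 2) / (2 * (m + 1))) := by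
      rw [← Real.rpow_natCast, ← Real.rpow_mul (by positivity)]
      congr 1
      rw [hs]; push_cast; ring
    have e3 : ((K ^ (m + 2)) ^ 2 * (q ^ 2)⁻¹ * (Sf * Sg) ^ (m + 2)) ^ s =
        ((K ^ (m + 2)) ^ 2 * (q ^ 2)⁻¹) ^ s * ((Sf * Sg) ^ (m + 2)) ^ s :=
      Real.mul_rpow (by positivity) (by positivity)
    rw [e1, e3, e2] at h1
    rw [hQ]
    refine mul_le_mul_of_nonneg_left ?_ (by positivity)
    refine mul_le_mul_of_nonneg_right ?_ (by positivity)
    refine h1.trans ?_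
    exact mul_le_mul_of_nonneg_right h2 (by positivity)
  have hmeas : ∀ j k, Measurable fun x => ENNReal.ofReal
      ((xrayAdjoint δ E (φ j) x * xrayAdjoint δ E (ψ k) x) ^ r) := fun j k =>
    (((measurable_xrayAdjoint δ E (φ j)).mul (measurable_xrayAdjoint δ E (ψ k))).pow_const
      r).ennreal_ofReal
  calc _ ≤ ∫⁻ x, ∑ j ∈ Finset.range (J + 1), ∑ k ∈ Finset.range (J + 1), ENNReal.ofReal
        ((xrayAdjoint δ E (φ j) x * xrayAdjoint δ E (ψ k) x) ^ r) := by
        refine lintegral_mono fun x => ?_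
        exact ofReal_mul_rpow_le_sum hr0 hr1 (fun j => xrayAdjoint_nonneg (hφ0 j) x)
          (fun j => xrayAdjoint_nonneg (hψ0 j) x) (xrayAdjoint_nonneg hf x)
          (xrayAdjoint_nonneg hg x) (xrayAdjoint_le_sum_of_le_sum hfφ x)
          (xrayAdjoint_le_sum_of_le_sum hgψ x)
    _ = ∑ j ∈ Finset.range (J + 1), ∑ k ∈ Finset.range (J + 1), ∫⁻ x, ENNReal.ofReal
        ((xrayAdjoint δ E (φ j) x * xrayAdjoint δ E (ψ k) x) ^ r) := by
        rw [lintegral_finsetSum _ fun j _ => Finset.measurable_fun_sum _ fun k _ => hmeas j k]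
        exact Finset.sum_congr rfl fun j _ => lintegral_finsetSum _ fun k _ => hmeas j k
    _ ≤ ∑ j ∈ Finset.range (J + 1), ∑ k ∈ Finset.range (J + 1), ENNReal.ofReal Q :=
        Finset.sum_le_sum fun j _ => Finset.sum_le_sum fun k _ => hpiece j k
    _ = ENNReal.ofReal (∑ j ∈ Finset.range (J + 1), ∑ k ∈ Finset.range (J + 1), Q) := by
        rw [ENNReal.ofReal_sum_of_nonneg fun j _ => Finset.sum_nonneg fun k _ => hQ0]
        exact Finset.sum_congr rfl fun j _ => (ENNReal.ofReal_sum_of_nonneg fun k _ => hQ0).symm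
    _ = _ := by
        congr 1
        have h3 : δ ^ (-(ε / 3)) * (q ^ 2)⁻¹ = δ ^ (-ε) := by
          rw [hq, ← Real.rpow_natCast, ← Real.rpow_mul hδ.le, ← Real.rpow_neg hδ.le,
            ← Real.rpow_add hδ]
          congr 1
          push_cast; ring
        simp only [Finset.sum_const, Finset.card_range, nsmul_eq_mul]
        push_cast
        rw [hQ, ← h3]
        ring

theorem mainTheorem2 (n : ℕ) (hn : 2 ≤ n) :
    BilinearKakeya n (((n : ℝ) + 2) / ((n : ℝ) + 1)) (((n : ℝ) + 2) / (2 * (n : ℝ))) := by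
  obtain ⟨m, rfl⟩ : ∃ m, n = m + 1 := ⟨n - 1, by omega⟩
  have hm : 1 ≤ m := by omega
  have hm1 : (1 : ℝ) ≤ m := by exact_mod_cast hm
  have ea : (((m + 1 : ℕ) : ℝ) + 2) / (((m + 1 : ℕ) : ℝ) + 1) = ((m : ℝ) + 3) / (m + 2) := by
    push_cast; ring
  have er : (((m + 1 : ℕ) : ℝ) + 2) / (2 * ((m + 1 : ℕ) : ℝ)) =
      ((m : ℝ) + 3) / (2 * (m + 1)) := by
    push_cast; ring
  rw [ea, er]
  set r : ℝ := ((m : ℝ) + 3) / (2 * (m + 1)) with hr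
  set a : ℝ := ((m : ℝ) + 3) / (m + 2) with ha
  have hr0 : 0 < r := by positivity
  intro c hc ε hε
  obtain ⟨C, hC, h⟩ := exists_lintegral_rpow_le m hm c hc (r * ε) (by positivity)
  refine ⟨C ^ (1 / r), by positivity, ?_⟩
  intro δ hδ hδ1 (E : Finset (EuclideanSpace ℝ (Fin m))) hE
    (E₁ : Finset (EuclideanSpace ℝ (Fin m))) (E₂ : Finset (EuclideanSpace ℝ (Fin m))) _ _ hsep
    (f : EuclideanSpace ℝ (Fin m) → EuclideanSpace ℝ (Fin m) → ℝ)
    (g : EuclideanSpace ℝ (Fin m) → EuclideanSpace ℝ (Fin m) → ℝ) hf hg hfE hgE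
  change eLpNorm (fun x : EuclideanSpace ℝ (Fin m) × ℝ =>
    xrayAdjoint δ E f x * xrayAdjoint δ E g x) (ENNReal.ofReal r) volume ≤ ENNReal.ofReal
      (C ^ (1 / r) * δ ^ (-ε) * δ ^ (-(2 * ((m + 1 : ℕ) : ℝ) * (1 - 1 / (2 * r))) + 2) *
        mixedNorm (m := m) δ E a f * mixedNorm (m := m) δ E a g)
  have hmain := h δ hδ hδ1 E hE.subset hE.separated f g hf hg
    (fun ω i ω' i' hfi hgi => hsep ω (by_contra fun hω => hfi (hfE ω i hω)) ω'
      (by_contra fun hω => hgi (hgE ω' i' hω)))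
  have hmix : ∀ g' : EuclideanSpace ℝ (Fin m) → EuclideanSpace ℝ (Fin m) → ℝ, (∀ ω i, 0 ≤ g' ω i) →
      mixedNorm (m := m) δ E a g' =
        δ ^ (m * (1 / a)) * (∑ ω ∈ E, (∑ i ∈ E, g' ω i) ^ a) ^ (1 / a) := by
    intro g' hg'
    rw [mixedNorm, ← Finset.mul_sum, Real.mul_rpow (by positivity)
      (Finset.sum_nonneg fun ω _ => Real.rpow_nonneg (Finset.sum_nonneg fun i _ => hg' ω i) _),
      ← Real.rpow_natCast, ← Real.rpow_mul hδ.le]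
  rw [hmix f hf, hmix g hg]
  set Sf := ∑ ω ∈ E, (∑ i ∈ E, f ω i) ^ a with hSf
  set Sg := ∑ ω ∈ E, (∑ i ∈ E, g ω i) ^ a with hSg
  have hSf0 : 0 ≤ Sf := Finset.sum_nonneg fun ω _ =>
    Real.rpow_nonneg (Finset.sum_nonneg fun i _ => hf ω i) _
  have hSg0 : 0 ≤ Sg := Finset.sum_nonneg fun ω _ =>
    Real.rpow_nonneg (Finset.sum_nonneg fun i _ => hg ω i) _
  rw [eLpNorm_eq_lintegral_rpow_enorm_toReal (by simpa using hr0) ENNReal.ofReal_ne_top,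
    ENNReal.toReal_ofReal hr0.le]
  have hint : ∀ x, ‖xrayAdjoint δ E f x * xrayAdjoint δ E g x‖ₑ ^ r =
      ENNReal.ofReal ((xrayAdjoint δ E f x * xrayAdjoint δ E g x) ^ r) := by
    intro x
    have h0 := mul_nonneg (xrayAdjoint_nonneg (δ := δ) (E := E) hf x)
      (xrayAdjoint_nonneg (δ := δ) (E := E) hg x)
    rw [Real.enorm_eq_ofReal h0, ENNReal.ofReal_rpow_of_nonneg h0 hr0.le]
  simp only [hint]
  refine (ENNReal.rpow_le_rpow hmain (by positivity)).trans_eq ?_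
  rw [ENNReal.ofReal_rpow_of_nonneg (by positivity) (by positivity)]
  congr 1
  rw [Real.mul_rpow (by positivity) (by positivity), Real.mul_rpow (by positivity) (by positivity),
    Real.mul_rpow (by positivity) (by positivity), ← Real.rpow_mul hδ.le, ← Real.rpow_mul hδ.le,
    ← Real.rpow_mul (by positivity)]
  have e1 : -(r * ε) * (1 / r) = -ε := by field_simp
  have e2 : ((m : ℝ) + 2) / (2 * (m + 1)) * (1 / r) = 1 / a := by
    rw [hr, ha]; field_simp
  have e3 : (1 + ((m : ℝ) + 1) * m) / (m + 1) * (1 / r) =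
      (-(2 * ((m + 1 : ℕ) : ℝ) * (1 - 1 / (2 * r))) + 2) + m * (1 / a) + m * (1 / a) := by
    rw [hr, ha]; push_cast; field_simp; ring
  rw [e1, e2, e3, Real.rpow_add hδ, Real.rpow_add hδ, Real.mul_rpow hSf0 hSg0]
  ring
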